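/- Let Alice and Bob each hold one bosonic mode. For $\vec r=(a,b,c,d)\in\mathbb R^4$ and $s\ge 0$ let $$\rho_{\vec r}=(D_{a+ib}\otimes D_{c+id})\,|\phi\rangle\langle\phi|\,(D_{a+ib}\otimes D_{c+id})^\dagger,\qquad D_\alpha=\exp(\alpha\hat a^\dagger-\alpha^*\hat a),$$ where $|\phi\rangle=\exp(s(\hat a_1^\dagger\hat a_2^\dagger-\hat a_1\hat a_2))|0\rangle$ is the two-mode squeezed vacuum with covariance matrix (vacuum normalised to the identity) $V_\rho=\begin{pmatrix}\cosh 2s\, I&\sinh 2s\, Z\\ \sinh 2s\, Z&\cosh 2s\, I\end{pmatrix}$, $Z=\mathrm{diag}(1,-1)$. For $\sigma>0$ let $P(\vec r)=\frac{1}{4\pi^2\sigma^4}e^{-(a^2+b^2+c^2+d^2)/2\sigma^2}$, let $\alpha=(a-c)(b+d)$, and let $$\rho_+=2\int_{\alpha>0}P(\vec r)\,\rho_{\vec r}\,d\vec r,\qquad \rho_-=2\int_{\alpha<0}P(\vec r)\,\rho_{\vec r}\,d\vec r .$$ One of $\rho_\pm$, each with probability $1/2$, is given, and the sign has to be guessed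 from the outcome of a measurement; the success probability is the probability that the guess is right. Fix $\sigma>0$. (1) (Nonlocal Gaussian measurements.) For every $s$ there are a Gaussian measurement $\Pi_{\vec y}=\frac1{\pi^2}D_{\vec y}\Pi_0D_{\vec y}^\dagger$, $\vec y\in\mathbb R^4$, where $D_{\vec y}=D_{y_1+iy_2}\otimes D_{y_3+iy_4}$ and $\Pi_0$ is the density operator of a two-mode Gaussian state with vanishing displacement, and a measurable set of outcomes on which $+$ is guessed ($-$ being guessed elsewhere), such that the success probability tends to $1$ as $s\to\infty$. (2) (GLOCC.) There is a constant $c<1$, depending only on $\sigma$, such that for every $s\ge0$ every measurement by Gaussian local operations and classical communication (a protocol in which every run has finitely many rounds, in each of which one party applies to his or her modes a Gaussian instrument with Gaussian Kraus operators, which may depend on all earlier outcomes, and announces the outcome; at the end no mode is left unmeasured, and the guess is a function of all outcomes) has success probability at most $c$. -/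

import Mathlib

open MeasureTheory Filter Topology InnerProductSpace
open scoped ENNReal

namespace DataHiding

noncomputable section

/-! ### Hilbert spaces of modes, trace, tensor products -/

/-- The Hilbert space `L²(ℝⁿ)` of `n` bosonic modes in the position representation. -/
abbrev Modes (n : ℕ) : Type := Lp ℂ 2 (volume : Measure (Fin n → ℝ))

/-- Bounded operators on the two-mode space (mode `0` is Alice's, mode `1` is Bob's). -/
abbrev Op : Type := Modes 2 →L[ℂ] Modes 2

/-- The trace `∑ᵢ ⟪bᵢ, T bᵢ⟫` along an orthonormal (Hilbert) basis. It is used for trace class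
operators only, where it does not depend on the basis. -/
def trace (T : Op) : ℂ :=
  let h := exists_hilbertBasis ℂ (Modes 2)
  ∑' i : h.choose, inner ℂ (h.choose_spec.choose i) (T (h.choose_spec.choose i))

theorem memLp_prodVec (f g : Modes 1) :
    MemLp (fun x : Fin 2 → ℝ => f (fun _ => x 0) * g (fun _ => x 1)) 2 volume := by
  have key : ∀ f : Modes 1, MemLp (fun t : ℝ => f (fun _ => t)) 2 volume := fun f =>
    (Lp.memLp f).comp_measurePreserving (volume_preserving_funUnique (Fin 1) ℝ).symm
  have hf := key f
  have hg := key g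
  let F : Fin 2 → ℝ → ℂ := ![fun t => f (fun _ => t), fun t => g (fun _ => t)]
  have h0 : ∀ i : Fin 2, AEStronglyMeasurable
      (fun x : Fin 2 → ℝ => F i (x i)) volume := by
    intro i
    have : AEStronglyMeasurable (F i) volume := by
      fin_cases i
      · exact hf.1
      · exact hg.1
    exact this.comp_quasiMeasurePreserving (Measure.quasiMeasurePreserving_eval _ i)
  have hm : AEStronglyMeasurable
      (fun x : Fin 2 → ℝ => f (fun _ => x 0) * g (fun _ => x 1)) volume := (h0 0).mul (h0 1)
  rw [memLp_two_iff_integrable_sq_norm hm]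
  have hI : Integrable (fun x : Fin 2 → ℝ => ∏ i, ‖F i (x i)‖ ^ 2) volume := by
    refine Integrable.fintype_prod (f := fun i t => ‖F i t‖ ^ 2) ?_
    intro i
    fin_cases i
    · exact (memLp_two_iff_integrable_sq_norm hf.1).1 hf
    · exact (memLp_two_iff_integrable_sq_norm hg.1).1 hg
  refine hI.congr (Eventually.of_forall fun x => ?_)
  simp [F, Fin.prod_univ_two, mul_pow]

/-- The product vector `f ⊗ g`, as the function `(x₀, x₁) ↦ f(x₀) g(x₁)`. -/
def prodVec (f g : Modes 1) : Modes 2 := (memLp_prodVec f g).toLp _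

/-! ### Displacement operators -/

/-- The position shift of the displacement `r = (a, b, c, d)`. -/
def shift (r : Fin 4 → ℝ) : Fin 2 → ℝ := ![√2 * r 0, √2 * r 2]

/-- The phase of the displacement `r = (a, b, c, d)`. -/
def phase (r : Fin 4 → ℝ) (x : Fin 2 → ℝ) : ℝ :=
  √2 * (r 1 * x 0 + r 3 * x 1) - r 0 * r 1 - r 2 * r 3

/-- The shifted function. -/
def translate (r : Fin 4 → ℝ) : Modes 2 →ₗᵢ[ℂ] Modes 2 :=
  Lp.compMeasurePreservingₗᵢ ℂ (fun x => x - shift r) (measurePreserving_sub_right volume (shift r))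

theorem memLp_modulate (r : Fin 4 → ℝ) (f : Modes 2) :
    MemLp (fun x => Complex.exp (phase r x * Complex.I) * f x) 2 volume := by
  have hc : Continuous fun x : Fin 2 → ℝ => Complex.exp (phase r x * Complex.I) := by
    unfold phase; fun_prop
  refine (Lp.memLp f).of_le (hc.aestronglyMeasurable.mul (Lp.memLp f).1)
    (Eventually.of_forall fun x => ?_)
  rw [norm_mul, Complex.norm_exp_ofReal_mul_I, one_mul]

/-- Multiplication by the phase. -/
def modulate (r : Fin 4 → ℝ) : Modes 2 →ₗᵢ[ℂ] Modes 2 where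
  toFun f := (memLp_modulate r f).toLp _
  map_add' f g := by
    refine Lp.ext ?_
    filter_upwards [(memLp_modulate r (f + g)).coeFn_toLp, (memLp_modulate r f).coeFn_toLp,
      (memLp_modulate r g).coeFn_toLp, Lp.coeFn_add f g,
      Lp.coeFn_add ((memLp_modulate r f).toLp _) ((memLp_modulate r g).toLp _)]
      with x h1 h2 h3 h4 h5
    rw [h1, h5, Pi.add_apply, h2, h3, h4, Pi.add_apply, mul_add]
  map_smul' c f := by
    refine Lp.ext ?_
    filter_upwards [(memLp_modulate r (c • f)).coeFn_toLp, (memLp_modulate r f).coeFn_toLp,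
      Lp.coeFn_smul c f, Lp.coeFn_smul c ((memLp_modulate r f).toLp _)] with x h1 h2 h3 h4
    rw [RingHom.id_apply, h1, h4, Pi.smul_apply, h2, h3, Pi.smul_apply, smul_eq_mul, smul_eq_mul]
    ring
  norm_map' f := by
    change ‖(memLp_modulate r f).toLp _‖ = ‖f‖
    rw [Lp.norm_toLp, Lp.norm_def]
    congr 1
    refine eLpNorm_congr_norm_ae (Eventually.of_forall fun x => ?_)
    rw [norm_mul, Complex.norm_exp_ofReal_mul_I, one_mul]

/-- The displacement operator `D_r = D_{a+ib} ⊗ D_{c+id}` for `r = (a, b, c, d)`, where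
`D_α = exp(α â† - α* â)` and `â = (q + i p) / √2`, `[q, p] = i`: for one mode,
`(D_{a+ib} ψ)(x) = exp(i √2 b x - i a b) ψ(x - √2 a)`. -/
def displacement (r : Fin 4 → ℝ) : Op :=
  (modulate r).toContinuousLinearMap ∘L (translate r).toContinuousLinearMap

/-! ### The data hiding states -/

/-- The wave function of the two-mode squeezed vacuum `exp(s (â₁† â₂† - â₁ â₂)) |0⟩`. -/
def squeezedFun (s : ℝ) (x : Fin 2 → ℝ) : ℂ :=
  ((√Real.pi)⁻¹ * Real.exp (-(Real.exp (2 * s) * (x 0 - x 1) ^ 2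
    + Real.exp (-(2 * s)) * (x 0 + x 1) ^ 2) / 4) : ℝ)

theorem memLp_squeezedFun (s : ℝ) : MemLp (squeezedFun s) 2 volume := by
  have hc : Continuous (squeezedFun s) := by unfold squeezedFun; fun_prop
  rw [memLp_two_iff_integrable_sq_norm hc.aestronglyMeasurable]
  obtain ⟨m, hm, h1, h2⟩ : ∃ m : ℝ, 0 < m ∧ m ≤ Real.exp (2 * s) ∧ m ≤ Real.exp (-(2 * s)) :=
    ⟨min (Real.exp (2 * s)) (Real.exp (-(2 * s))), lt_min (Real.exp_pos _) (Real.exp_pos _),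
      min_le_left _ _, min_le_right _ _⟩
  have hI : Integrable (fun x : Fin 2 → ℝ => ∏ i, Real.exp (-m * (x i) ^ 2)) volume :=
    Integrable.fintype_prod (f := fun _ t => Real.exp (-m * t ^ 2))
      fun _ => integrable_exp_neg_mul_sq hm
  refine (hI.const_mul (((√Real.pi)⁻¹) ^ 2)).mono' (by fun_prop) (Eventually.of_forall fun x => ?_)
  rw [Real.norm_of_nonneg (by positivity), squeezedFun, Complex.norm_real, Real.norm_eq_abs,
    sq_abs, mul_pow, Fin.prod_univ_two, ← Real.exp_nat_mul, ← Real.exp_add]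
  refine mul_le_mul_of_nonneg_left (Real.exp_le_exp.2 ?_) (by positivity)
  push_cast
  nlinarith [mul_le_mul_of_nonneg_right h1 (sq_nonneg (x 0 - x 1)),
    mul_le_mul_of_nonneg_right h2 (sq_nonneg (x 0 + x 1))]

/-- The two-mode squeezed vacuum `|φ⟩` with squeezing parameter `s`. -/
def squeezedVacuum (s : ℝ) : Modes 2 := (memLp_squeezedFun s).toLp _

/-- The displaced two-mode squeezed state `ρ_r = D_r |φ⟩⟨φ| D_r†`. -/
def rho (s : ℝ) (r : Fin 4 → ℝ) : Op :=
  displacement r ∘L rankOne ℂ (squeezedVacuum s) (squeezedVacuum s) ∘L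
    ContinuousLinearMap.adjoint (displacement r)

/-- The Gaussian prior density of `r = (a, b, c, d)`. -/
def prior (σ : ℝ) (r : Fin 4 → ℝ) : ℝ :=
  1 / (4 * Real.pi ^ 2 * σ ^ 4) * Real.exp (-(∑ i, r i ^ 2) / (2 * σ ^ 2))

/-- The quantity `α = (a - c)(b + d)` whose sign encodes the bit. -/
def alpha (r : Fin 4 → ℝ) : ℝ := (r 0 - r 2) * (r 1 + r 3)

/-- The state `ρ₊ = 2 ∫_{α > 0} P(r) ρ_r dr`. -/
def rhoPlus (σ s : ℝ) : Op := (2 : ℝ) • ∫ r in {r | 0 < alpha r}, prior σ r • rho s r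

/-- The state `ρ₋ = 2 ∫_{α < 0} P(r) ρ_r dr`. -/
def rhoMinus (σ s : ℝ) : Op := (2 : ℝ) • ∫ r in {r | alpha r < 0}, prior σ r • rho s r

/-! ### Gaussian measurements -/

/-- The symplectic form of two modes, in the order `(q₁, p₁, q₂, p₂)`. -/
def Omega : Matrix (Fin 4) (Fin 4) ℝ :=
  !![0, 1, 0, 0; -1, 0, 0, 0; 0, 0, 0, 1; 0, 0, -1, 0]

/-- `T` is the density operator of a Gaussian state with vanishing displacement and covariance
matrix `V` (normalised so that the vacuum has covariance matrix `1`): it is positive with trace `1`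
and its characteristic function `ξ ↦ tr(T D_ξ)` is `exp(-½ (Ωξ)ᵀ V (Ωξ))`. -/
def IsCenteredGaussianState (T : Op) (V : Matrix (Fin 4) (Fin 4) ℝ) : Prop :=
  T.IsPositive ∧ trace T = 1 ∧ V.IsSymm ∧
    ∀ ξ : Fin 4 → ℝ, trace (T ∘L displacement ξ) =
      (Real.exp (-(1 / 2) * (Omega.mulVec ξ ⬝ᵥ V.mulVec (Omega.mulVec ξ))) : ℝ)

/-- The element `π⁻² D_y T D_y†` of the Gaussian measurement with seed `T`; the outcome `y`
ranges over `ℝ⁴` with Lebesgue measure. -/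
def povmElement (T : Op) (y : Fin 4 → ℝ) : Op :=
  (1 / Real.pi ^ 2 : ℝ) •
    (displacement y ∘L T ∘L ContinuousLinearMap.adjoint (displacement y))

/-- The probability of identifying the sign of `α` (equivalently, which of the two equally likely
states `ρ₊`, `ρ₋` is present) from the outcome `y` of the Gaussian measurement with seed `T`, when
the guess is `+` for `y ∈ S` and `-` otherwise. -/
def gaussianSuccess (σ s : ℝ) (T : Op) (S : Set (Fin 4 → ℝ)) : ℝ :=
  1 / 2 * ((∫ y in S, (trace (povmElement T y ∘L rhoPlus σ s)).re) +
    ∫ y in Sᶜ, (trace (povmElement T y ∘L rhoMinus σ s)).re)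

/-! ### Gaussian local operations and classical communication -/

/-- Pure Gaussian vectors of `n` modes, not necessarily normalised: wave functions
`exp(-½ xᵀ M x + vᵀ x + c)`, with `M` complex symmetric with positive definite real part. -/
def IsGaussianVec {n : ℕ} (f : Modes n) : Prop :=
  ∃ (M : Matrix (Fin n) (Fin n) ℂ) (v : Fin n → ℂ) (c : ℂ),
    M.IsSymm ∧ (M.map Complex.re).PosDef ∧
    ∀ᵐ x : Fin n → ℝ, f x = Complex.exp (-(1 / 2) * ((fun i => (x i : ℂ)) ⬝ᵥ
      M.mulVec fun i => (x i : ℂ)) + (v ⬝ᵥ fun i => (x i : ℂ)) + c)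

/-- Gaussian Kraus operators from `m` to `n` modes: `L` and its adjoint map every pure Gaussian
vector to a pure Gaussian vector or to `0`. Gaussian unitaries, the adjunction of ancillary modes
in Gaussian states, and projections of some of the modes on Gaussian vectors are of this kind. -/
def IsGaussianOp {m n : ℕ} (L : Modes m →L[ℂ] Modes n) : Prop :=
  (∀ f, IsGaussianVec f → L f = 0 ∨ IsGaussianVec (L f)) ∧
    ∀ f, IsGaussianVec f → ContinuousLinearMap.adjoint L f = 0 ∨
      IsGaussianVec (ContinuousLinearMap.adjoint L f)

/-- A Gaussian instrument from `m` to `n` modes with outcomes in `X`: Gaussian Kraus operators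
`L x` with `∫ (L x)† (L x) dμ(x) = 1`. -/
structure IsGaussianInstrument {m n : ℕ} {X : Type} [MeasurableSpace X] (μ : Measure X)
    (L : X → Modes m →L[ℂ] Modes n) : Prop where
  gaussian : ∀ x, IsGaussianOp (L x)
  measurable : ∀ ψ, StronglyMeasurable fun x => L x ψ
  complete : ∀ ψ, ∫⁻ x, ENNReal.ofReal (‖L x ψ‖ ^ 2) ∂μ = ENNReal.ofReal (‖ψ‖ ^ 2)

theorem memLp_unitVec : MemLp (fun _ : Fin 0 → ℝ => (1 : ℂ)) 2 volume := memLp_const 1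

/-- The unit vector of the one-dimensional space of zero modes. -/
def unitVec : Modes 0 := memLp_unitVec.toLp _

/-- `IsGLOCC KA KB p`: suppose that the local operations done so far, with the outcomes obtained,
have the accumulated Kraus operators `KA` on Alice's side and `KB` on Bob's side. Then
there is a way to go on with finitely many rounds of Gaussian local operations and classical
communication, and to guess the sign at the end, such that `p b ρ` is the total weight
`tr(ρ E)` with which the guess is `b` if the initial state is `ρ`.

In each round one party applies a Gaussian instrument to his or her modes and announces the outcome,
and everything that follows may depend on it. At the end all modes have been measured. (No
generality is lost: outcomes may be ignored, so modes may be discarded and mixed operations and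
classical randomness are covered.) -/
inductive IsGLOCC : {m n : ℕ} → (Modes 1 →L[ℂ] Modes m) → (Modes 1 →L[ℂ] Modes n) →
    (Bool → Op → ℝ≥0∞) → Prop
  | guess (KA KB : Modes 1 →L[ℂ] Modes 0) (b : Bool) :
      IsGLOCC KA KB fun b' ρ =>
        if b' = b then
          ENNReal.ofReal (inner ℂ
            (prodVec (ContinuousLinearMap.adjoint KA unitVec)
              (ContinuousLinearMap.adjoint KB unitVec))
            (ρ (prodVec (ContinuousLinearMap.adjoint KA unitVec)
              (ContinuousLinearMap.adjoint KB unitVec)))).re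
        else 0
  | alice {m m' n : ℕ} (KA : Modes 1 →L[ℂ] Modes m) (KB : Modes 1 →L[ℂ] Modes n)
      (X : Type) [MeasurableSpace X] (μ : Measure X) [SigmaFinite μ]
      (L : X → Modes m →L[ℂ] Modes m') (hL : IsGaussianInstrument μ L)
      (p : X → Bool → Op → ℝ≥0∞) (hp : ∀ x, IsGLOCC (L x ∘L KA) KB (p x))
      (hmeas : ∀ (b : Bool) (ρ : Op), ρ.IsPositive → AEMeasurable (fun x => p x b ρ) μ) :
      IsGLOCC KA KB fun b ρ => ∫⁻ x, p x b ρ ∂μ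
  | bob {m n n' : ℕ} (KA : Modes 1 →L[ℂ] Modes m) (KB : Modes 1 →L[ℂ] Modes n)
      (X : Type) [MeasurableSpace X] (μ : Measure X) [SigmaFinite μ]
      (L : X → Modes n →L[ℂ] Modes n') (hL : IsGaussianInstrument μ L)
      (p : X → Bool → Op → ℝ≥0∞) (hp : ∀ x, IsGLOCC KA (L x ∘L KB) (p x))
      (hmeas : ∀ (b : Bool) (ρ : Op), ρ.IsPositive → AEMeasurable (fun x => p x b ρ) μ) :
      IsGLOCC KA KB fun b ρ => ∫⁻ x, p x b ρ ∂μ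

/-- `p b ρ` are the probabilities of the guess `b` (`true` for `+`, `false` for `-`) of a GLOCC
measurement on the two-mode state `ρ`, one mode of which belongs to Alice and one to Bob. -/
def IsGLOCCMeasurement (p : Bool → Op → ℝ≥0∞) : Prop :=
  IsGLOCC (ContinuousLinearMap.id ℂ (Modes 1)) (ContinuousLinearMap.id ℂ (Modes 1)) p

/-- The probability that the guess is the sign of `α`. -/
def gloccSuccess (σ s : ℝ) (p : Bool → Op → ℝ≥0∞) : ℝ≥0∞ :=
  (p true (rhoPlus σ s) + p false (rhoMinus σ s)) / 2

end

end DataHiding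

namespace DataHiding

noncomputable section

/-! ### Displacement operators -/

/-! For the nonlocal measurement the seed is the squeezed vacuum itself. Given `r`, the outcome
error has density `π⁻² exp (-squeezedForm s x)`, and `squeezedForm` equals `e^{2s}/2 ((a-c)² +
(b+d)²) + e^{-2s}/2 ((a+c)² + (b-d)²)`. Thus `a - c` and `b + d`, the only combinations that enter
`alpha`, are seen with error of order `e^{-s}`. Since `alpha ≠ 0` almost everywhere, guessing the
sign of `alpha y` is asymptotically always right (`tendsto_gaussianSuccess`).

In a GLOCC protocol every leaf projects on a product `f ⊗ g` of Gaussian vectors (or on zero), so it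
is seen through `G r = ‖⟪f ⊗ g, state s r⟫‖²`. This function is log-quadratic in `r`, and by an
uncertainty argument some direction `e` in Alice's phase plane satisfies `G r ≤ e^{4t²} √(G (r + te)
G (r - te))`, with normalised `e` and no dependence on `s` (`exists_direction`). Along `e` one of `a
- c`, `b + d` moves at unit speed. A line through the unit box therefore soon meets displacements of
the wrong sign, unless the other factor is small too, and then it meets a small box around `a - c =
b + d = 0`. Averaging over the line, a leaf that sees the unit box must also see the wrong sign, the
small box, or (with small coefficient) a larger box: `lintegral_box_overlap_le`.

This inequality is linear in `G`. Hence the weight of a correct guess at any leaf is at most the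
integral of `G` against `2 * weight`, a slightly modified prior independent of leaf and of `s`
(`ofReal_inner_rhoSign_le`). Completeness of the instruments conserves the total weight from round
to round, so the success probability is at most `∫ weight` (`IsGLOCC.le_lintegral_branchWeight`,
`gloccSuccess_le`). The small box costs order `η²` and the gain on the unit box is of order `η`, so
suitable `κ` and `η` make this integral less than `1`. -/

theorem displacement_ae (r : Fin 4 → ℝ) (ψ : Modes 2) :
    displacement r ψ =ᵐ[volume]
      fun x => Complex.exp (phase r x * Complex.I) * ψ (x - shift r) := by
  have h1 : displacement r ψ =ᵐ[volume]
      fun x => Complex.exp (phase r x * Complex.I) * (translate r ψ) x :=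
    (memLp_modulate r (translate r ψ)).coeFn_toLp
  have h2 : translate r ψ =ᵐ[volume] fun x => ψ (x - shift r) :=
    Lp.coeFn_compMeasurePreserving ψ (measurePreserving_sub_right volume (shift r))
  filter_upwards [h1, h2] with x hx1 hx2
  rw [hx1, hx2]

theorem norm_displacement (r : Fin 4 → ℝ) (ψ : Modes 2) : ‖displacement r ψ‖ = ‖ψ‖ := by
  simp [displacement]

theorem inner_displacement (r : Fin 4 → ℝ) (ψ χ : Modes 2) :
    inner ℂ (displacement r ψ) (displacement r χ) = inner ℂ ψ χ := by
  simp [displacement]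

/-- The Weyl relations. -/
theorem displacement_displacement (y z : Fin 4 → ℝ) (ψ : Modes 2) :
    displacement y (displacement z ψ) =
      Complex.exp ((z 0 * y 1 - z 1 * y 0 + z 2 * y 3 - z 3 * y 2 : ℝ) * Complex.I) •
        displacement (y + z) ψ := by
  refine Lp.ext ?_
  have hz := (measurePreserving_sub_right volume (shift y)).quasiMeasurePreserving.ae
    (displacement_ae z ψ)
  filter_upwards [displacement_ae y (displacement z ψ), hz, displacement_ae (y + z) ψ,
    Lp.coeFn_smul (Complex.exp ((z 0 * y 1 - z 1 * y 0 + z 2 * y 3 - z 3 * y 2 : ℝ) * Complex.I))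
      (displacement (y + z) ψ)] with x h1 h2 h3 h4
  have hs : x - shift y - shift z = x - shift (y + z) := by
    have : shift (y + z) = shift y + shift z := by
      ext i; fin_cases i <;> simp [shift, mul_add]
    rw [this, sub_sub]
  rw [h1, h2, h4, Pi.smul_apply, h3, hs, smul_eq_mul, ← mul_assoc, ← mul_assoc, ← Complex.exp_add,
    ← Complex.exp_add]
  congr 2
  rw [← add_mul, ← add_mul, ← Complex.ofReal_add, ← Complex.ofReal_add]
  congr 2
  have h2 : √2 * √2 = 2 := by norm_num
  simp only [phase, shift, Pi.add_apply, Pi.sub_apply, Matrix.cons_val_zero, Matrix.cons_val_one]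
  linear_combination (-(z 1 * y 0) - z 3 * y 2) * h2

/-! ### Gaussian integrals in two variables -/

theorem integral_fin_two {f : (Fin 2 → ℝ) → ℂ} (hf : Integrable f) :
    ∫ x, f x = ∫ x : ℝ, ∫ y : ℝ, f ![x, y] := by
  have hmp := (volume_preserving_finTwoArrow ℝ).symm
  rw [← hmp.integral_comp', Measure.volume_eq_prod, integral_prod]
  · rfl
  · exact hmp.integrable_comp_of_integrable hf

/-- The square is completed in the second variable; the Schur complement `p - m ^ 2 / q` governs the
first. Two separate principal square roots avoid choosing a branch for the root of the complex
determinant. -/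
theorem integral_cexp_quadratic_two {p m q w₀ w₁ k : ℂ} (hq : 0 < q.re)
    (hp : 0 < (p - m ^ 2 / q).re)
    (hI : Integrable fun x : Fin 2 → ℝ => Complex.exp (-(1 / 2) * (p * x 0 ^ 2 + 2 * m * x 0 * x 1
      + q * x 1 ^ 2) + w₀ * x 0 + w₁ * x 1 + k)) :
    ∫ x : Fin 2 → ℝ, Complex.exp (-(1 / 2) * (p * x 0 ^ 2 + 2 * m * x 0 * x 1
      + q * x 1 ^ 2) + w₀ * x 0 + w₁ * x 1 + k) =
      (Real.pi / (q / 2)) ^ (1 / 2 : ℂ) * (Real.pi / ((p - m ^ 2 / q) / 2)) ^ (1 / 2 : ℂ) *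
        Complex.exp (k + w₁ ^ 2 / (2 * q) + (w₀ - m * w₁ / q) ^ 2 / (2 * (p - m ^ 2 / q))) := by
  have hq0 : q ≠ 0 := fun h => by simp [h] at hq
  have hp0 : p - m ^ 2 / q ≠ 0 := fun h => by simp [h] at hp
  rw [integral_fin_two hI]
  simp only [Matrix.cons_val_zero, Matrix.cons_val_one]
  have inner : ∀ x : ℝ, ∫ y : ℝ, Complex.exp (-(1 / 2) * (p * x ^ 2 + 2 * m * x * y
      + q * y ^ 2) + w₀ * x + w₁ * y + k) = (Real.pi / (q / 2)) ^ (1 / 2 : ℂ) *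
      Complex.exp (-((p - m ^ 2 / q) / 2) * x ^ 2 + (w₀ - m * w₁ / q) * x +
        (k + w₁ ^ 2 / (2 * q))) := by
    intro x
    have hre : (-(q / 2)).re < 0 := by
      rw [Complex.neg_re, Complex.div_ofNat_re]; linarith
    have := integral_cexp_quadratic hre (w₁ - m * x) (-(1 / 2) * p * x ^ 2 + w₀ * x + k)
    rw [neg_neg] at this
    convert this using 3
    · ring_nf
    · field_simp; ring
  have hre : (-((p - m ^ 2 / q) / 2)).re < 0 := by
    rw [Complex.neg_re, Complex.div_ofNat_re]; linarith
  have outer := integral_cexp_quadratic hre (w₀ - m * w₁ / q) (k + w₁ ^ 2 / (2 * q))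
  rw [neg_neg] at outer
  rw [integral_congr_ae (Eventually.of_forall inner), integral_const_mul, outer, ← mul_assoc]
  congr 2
  generalize p - m ^ 2 / q = Z at hp0
  field_simp
  ring

/-! ### The squeezed vacuum -/

theorem squeezedVacuum_ae (s : ℝ) : squeezedVacuum s =ᵐ[volume] squeezedFun s :=
  (memLp_squeezedFun s).coeFn_toLp

theorem displacement_squeezedVacuum_ae (s : ℝ) (r : Fin 4 → ℝ) :
    displacement r (squeezedVacuum s) =ᵐ[volume]
      fun x => (√Real.pi : ℂ)⁻¹ * Complex.exp (-(1 / 2) * (Real.cosh (2 * s) * x 0 ^ 2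
        + 2 * (-Real.sinh (2 * s)) * x 0 * x 1 + Real.cosh (2 * s) * x 1 ^ 2)
        + √2 * (Real.cosh (2 * s) * r 0 - Real.sinh (2 * s) * r 2 + r 1 * Complex.I) * x 0
        + √2 * (Real.cosh (2 * s) * r 2 - Real.sinh (2 * s) * r 0 + r 3 * Complex.I) * x 1
        + (-Real.cosh (2 * s) * (r 0 ^ 2 + r 2 ^ 2) + 2 * Real.sinh (2 * s) * r 0 * r 2
          - (r 0 * r 1 + r 2 * r 3) * Complex.I)) := by
  have h := (measurePreserving_sub_right volume (shift r)).quasiMeasurePreserving.ae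
    (squeezedVacuum_ae s)
  filter_upwards [displacement_ae r (squeezedVacuum s), h] with x h1 h2
  have h2' : (√2 : ℂ) * √2 = 2 := by
    rw [← Complex.ofReal_mul]; norm_num
  rw [h1, h2, squeezedFun, Complex.ofReal_mul, mul_left_comm, Complex.ofReal_exp,
    ← Complex.exp_add, Complex.ofReal_inv]
  congr 2
  rw [Real.cosh_eq, Real.sinh_eq]
  simp only [phase, shift, Pi.sub_apply, Matrix.cons_val_zero, Matrix.cons_val_one]
  push_cast
  generalize Complex.exp (2 * s) = E
  generalize Complex.exp (-(2 * s)) = F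
  linear_combination (-(E * (r 0 - r 2) ^ 2 + F * (r 0 + r 2) ^ 2) / 4) * h2'

/-- The quadratic form `ξ ↦ (Ωξ)ᵀ V (Ωξ)` of the squeezed vacuum. -/
def squeezedForm (s : ℝ) (r : Fin 4 → ℝ) : ℝ :=
  Real.cosh (2 * s) * (r 0 ^ 2 + r 1 ^ 2 + r 2 ^ 2 + r 3 ^ 2)
    + 2 * Real.sinh (2 * s) * (r 1 * r 3 - r 0 * r 2)

/-- This characteristic function is the single explicit computation behind the norm, all overlaps,
the continuity of `state` and the Gaussianity of the seed. -/
theorem inner_squeezedVacuum_displacement (s : ℝ) (r : Fin 4 → ℝ) :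
    inner ℂ (squeezedVacuum s) (displacement r (squeezedVacuum s)) =
      (Real.exp (-(1 / 2) * squeezedForm s r) : ℝ) := by
  have hae : (fun x => inner ℂ (squeezedVacuum s x) (displacement r (squeezedVacuum s) x))
      =ᵐ[volume] fun x => (√Real.pi : ℂ)⁻¹ * (√Real.pi : ℂ)⁻¹ *
        Complex.exp (-(1 / 2) * ((2 * Real.cosh (2 * s) : ℂ) * x 0 ^ 2
        + 2 * (-2 * Real.sinh (2 * s)) * x 0 * x 1 + (2 * Real.cosh (2 * s) : ℂ) * x 1 ^ 2)
        + √2 * (Real.cosh (2 * s) * r 0 - Real.sinh (2 * s) * r 2 + r 1 * Complex.I) * x 0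
        + √2 * (Real.cosh (2 * s) * r 2 - Real.sinh (2 * s) * r 0 + r 3 * Complex.I) * x 1
        + (-Real.cosh (2 * s) * (r 0 ^ 2 + r 2 ^ 2) + 2 * Real.sinh (2 * s) * r 0 * r 2
          - (r 0 * r 1 + r 2 * r 3) * Complex.I)) := by
    filter_upwards [squeezedVacuum_ae s, displacement_squeezedVacuum_ae s r] with x h1 h2
    rw [h1, h2, RCLike.inner_apply, squeezedFun, Complex.conj_ofReal, Complex.ofReal_mul,
      mul_mul_mul_comm, mul_comm, Complex.ofReal_exp, ← Complex.exp_add, Complex.ofReal_inv,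
      mul_comm]
    congr 2
    rw [Real.cosh_eq, Real.sinh_eq]
    push_cast
    ring_nf
  have hC := Real.cosh_pos (2 * s)
  have hcs := Real.cosh_sq (2 * s)
  -- The Schur complement simplifies because `cosh² - sinh² = 1`; the two square roots then multiply
  -- to `π`.
  have hZ : (2 * Real.cosh (2 * s) : ℂ) - (-2 * Real.sinh (2 * s)) ^ 2 / (2 * Real.cosh (2 * s)) =
      (2 / Real.cosh (2 * s) : ℝ) := by
    norm_cast
    push_cast
    field_simp
    linear_combination hcs
  have hpi : ((√Real.pi : ℂ)⁻¹ * (√Real.pi : ℂ)⁻¹) ≠ 0 := by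
    have : (√Real.pi : ℂ) ≠ 0 := by exact_mod_cast (Real.sqrt_pos.2 Real.pi_pos).ne'
    simp [this]
  have hI := (L2.integrable_inner (𝕜 := ℂ) (squeezedVacuum s)
    (displacement r (squeezedVacuum s))).congr hae
  rw [integrable_const_mul_iff (IsUnit.mk0 _ hpi)] at hI
  rw [L2.inner_def, integral_congr_ae hae, integral_const_mul, integral_cexp_quadratic_two
    (by norm_cast; positivity) (by rw [hZ, Complex.ofReal_re]; positivity) hI, hZ, ← mul_assoc]
  have hn : (√Real.pi : ℂ)⁻¹ * (√Real.pi : ℂ)⁻¹ *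
      ((Real.pi / (2 * Real.cosh (2 * s) / 2)) ^ (1 / 2 : ℂ) *
      (Real.pi / ((2 / Real.cosh (2 * s) : ℝ) / 2)) ^ (1 / 2 : ℂ)) = 1 := by
    have e1 : (Real.pi / (2 * Real.cosh (2 * s) / 2) : ℂ) ^ (1 / 2 : ℂ) =
        (√(Real.pi / Real.cosh (2 * s)) : ℝ) := by
      rw [Real.sqrt_eq_rpow, Complex.ofReal_cpow (by positivity)]
      push_cast
      congr 1
      ring
    have e2 : (Real.pi / ((2 / Real.cosh (2 * s) : ℝ) / 2) : ℂ) ^ (1 / 2 : ℂ) =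
        (√(Real.pi * Real.cosh (2 * s)) : ℝ) := by
      rw [Real.sqrt_eq_rpow, Complex.ofReal_cpow (by positivity)]
      push_cast
      congr 1
      field_simp
    rw [e1, e2]
    norm_cast
    rw [← Real.sqrt_mul (by positivity), ← mul_inv, Real.mul_self_sqrt Real.pi_pos.le,
      show Real.pi / Real.cosh (2 * s) * (Real.pi * Real.cosh (2 * s)) = Real.pi ^ 2 by field_simp,
      Real.sqrt_sq Real.pi_pos.le]
    field_simp
  rw [hn, one_mul, Complex.ofReal_exp]
  congr 1
  have h2' : (√2 : ℂ) ^ 2 = 2 := by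
    rw [← Complex.ofReal_pow]; norm_num
  have hC' : (Real.cosh (2 * s) : ℂ) ≠ 0 := by exact_mod_cast hC.ne'
  have hcs' : (Real.cosh (2 * s) : ℂ) ^ 2 = Real.sinh (2 * s) ^ 2 + 1 := by exact_mod_cast hcs
  have hI2 := Complex.I_sq
  rw [squeezedForm]
  push_cast [-Complex.ofReal_cosh, -Complex.ofReal_sinh]
  generalize (Real.cosh (2 * s) : ℂ) = C at *
  generalize (Real.sinh (2 * s) : ℂ) = S at *
  generalize Complex.I = J at *
  field_simp
  rw [h2']
  clear hae hI hZ hn hpi hcs h2'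
  grind

theorem displacement_zero (ψ : Modes 2) : displacement 0 ψ = ψ := by
  refine Lp.ext ?_
  filter_upwards [displacement_ae 0 ψ] with x h
  have : shift 0 = 0 := by ext i; fin_cases i <;> simp [shift]
  rw [h, this]
  simp [phase]

theorem norm_squeezedVacuum (s : ℝ) : ‖squeezedVacuum s‖ = 1 := by
  have h := inner_squeezedVacuum_displacement s 0
  rw [displacement_zero, inner_self_eq_norm_sq_to_K] at h
  simp only [squeezedForm, Pi.zero_apply, ne_eq, OfNat.ofNat_ne_zero, not_false_eq_true, zero_pow,
    add_zero, mul_zero, sub_zero, Real.exp_zero] at h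
  have h' : ‖squeezedVacuum s‖ ^ 2 = 1 := Complex.ofReal_injective (by push_cast; exact h)
  exact (pow_eq_one_iff_of_nonneg (norm_nonneg _) two_ne_zero).1 h'

/-- The displaced squeezed state vector `D_r |φ⟩`. -/
def state (s : ℝ) (r : Fin 4 → ℝ) : Modes 2 := displacement r (squeezedVacuum s)

theorem norm_state (s : ℝ) (r : Fin 4 → ℝ) : ‖state s r‖ = 1 := by
  rw [state, norm_displacement, norm_squeezedVacuum]

theorem inner_state (s : ℝ) (y r : Fin 4 → ℝ) :
    inner ℂ (state s y) (state s r) =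
      Complex.exp (-((r 0 * y 1 - r 1 * y 0 + r 2 * y 3 - r 3 * y 2 : ℝ) * Complex.I)) *
        (Real.exp (-(1 / 2) * squeezedForm s (r - y)) : ℝ) := by
  have h := displacement_displacement y (r - y) (squeezedVacuum s)
  rw [add_sub_cancel] at h
  have h' : state s r = Complex.exp (-((r 0 * y 1 - r 1 * y 0 + r 2 * y 3 - r 3 * y 2 : ℝ)
      * Complex.I)) • displacement y (displacement (r - y) (squeezedVacuum s)) := by
    rw [h, smul_smul, ← Complex.exp_add, state]
    conv_lhs => rw [← one_smul ℂ (displacement r (squeezedVacuum s)), ← Complex.exp_zero]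
    congr 2
    simp only [Pi.sub_apply]
    push_cast
    ring
  rw [h', inner_smul_right, state, inner_displacement, inner_squeezedVacuum_displacement]

theorem norm_inner_state (s : ℝ) (y r : Fin 4 → ℝ) :
    ‖inner ℂ (state s y) (state s r)‖ ^ 2 = Real.exp (-squeezedForm s (r - y)) := by
  rw [inner_state, ← neg_mul, ← Complex.ofReal_neg, norm_mul, Complex.norm_exp_ofReal_mul_I, one_mul,
    Complex.norm_real, Real.norm_of_nonneg (Real.exp_pos _).le, ← Real.exp_nat_mul]
  congr 1
  push_cast
  ring

/-- For unit vectors `‖u - v‖² = 2 - 2 Re ⟪u, v⟫`, and the overlap is explicit. -/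
theorem continuous_state (s : ℝ) : Continuous (state s) := by
  refine continuous_iff_continuousAt.2 fun y => ?_
  rw [ContinuousAt, tendsto_iff_norm_sub_tendsto_zero]
  have hc : Continuous fun r => √(2 - 2 * (inner ℂ (state s y) (state s r)).re) := by
    simp_rw [inner_state, squeezedForm]
    fun_prop
  have h0 : √(2 - 2 * (inner ℂ (state s y) (state s y)).re) = 0 := by
    rw [inner_self_eq_norm_sq_to_K, norm_state]
    norm_num
  rw [← h0]
  refine (hc.tendsto y).congr fun r => ?_
  have := norm_sub_sq (𝕜 := ℂ) (state s r) (state s y)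
  rw [norm_state, norm_state, ← inner_conj_symm, RCLike.conj_re, RCLike.re_to_complex] at this
  rw [← Real.sqrt_sq (norm_nonneg (state s r - state s y)), this]
  congr 1
  ring

theorem rho_eq (s : ℝ) (r : Fin 4 → ℝ) : rho s r = rankOne ℂ (state s r) (state s r) := by
  rw [rho, rankOne_comp, comp_rankOne, ContinuousLinearMap.adjoint_adjoint, state]

/-! ### The prior -/

theorem prior_pos {σ : ℝ} (hσ : 0 < σ) (r : Fin 4 → ℝ) : 0 < prior σ r := by
  unfold prior; positivity

theorem continuous_prior (σ : ℝ) : Continuous (prior σ) := by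
  unfold prior; fun_prop

theorem prior_eq_prod (σ : ℝ) (r : Fin 4 → ℝ) : prior σ r =
    1 / (4 * Real.pi ^ 2 * σ ^ 4) * ∏ i, Real.exp (-(1 / (2 * σ ^ 2)) * r i ^ 2) := by
  rw [prior, ← Real.exp_sum, ← Finset.mul_sum]
  congr 2
  ring

theorem integrable_prior {σ : ℝ} (hσ : 0 < σ) : Integrable (prior σ) := by
  simp_rw [funext (prior_eq_prod σ)]
  exact (Integrable.fintype_prod (f := fun _ t => Real.exp (-(1 / (2 * σ ^ 2)) * t ^ 2))
    fun _ => integrable_exp_neg_mul_sq (by positivity)).const_mul _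

theorem integral_prior {σ : ℝ} (hσ : 0 < σ) : ∫ r, prior σ r = 1 := by
  simp_rw [prior_eq_prod, integral_const_mul]
  rw [integral_fintype_prod_volume_eq_pow (fun t : ℝ => Real.exp (-(1 / (2 * σ ^ 2)) * t ^ 2)),
    integral_gaussian, Fintype.card_fin, pow_mul (√_) 2 2, Real.sq_sqrt (by positivity)]
  field_simp
  norm_num

theorem integrable_prior_smul_rho {σ : ℝ} (hσ : 0 < σ) (s : ℝ) :
    Integrable fun r => prior σ r • rho s r := by
  refine (integrable_prior hσ).mono ?_ (Eventually.of_forall fun r => ?_)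
  · refine Continuous.aestronglyMeasurable ?_
    have h : Continuous fun r => rankOne ℂ (state s r) (state s r) :=
      (ContinuousLinearMap.smulRightL ℂ (Modes 2) (Modes 2)).continuous₂.comp
        (((innerSL ℂ).continuous.comp (continuous_state s)).prodMk (continuous_state s))
    simp_rw [rho_eq]
    exact (continuous_prior σ).smul h
  · rw [norm_smul, rho_eq, norm_rankOne, norm_state, mul_one, mul_one]

theorem inner_setIntegral_rho {σ : ℝ} (hσ : 0 < σ) (s : ℝ) (A : Set (Fin 4 → ℝ)) (h : Modes 2) :
    inner ℂ h ((∫ r in A, prior σ r • rho s r) h) =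
      ((∫ r in A, prior σ r * ‖inner ℂ h (state s r)‖ ^ 2 : ℝ) : ℂ) := by
  have hI := (integrable_prior_smul_rho hσ s).integrableOn (s := A)
  rw [ContinuousLinearMap.integral_apply hI, ← integral_inner (hI.apply_continuousLinearMap h),
    ← integral_complex_ofReal]
  congr 1 with r
  rw [_root_.smul_apply, rho_eq, rankOne_apply, inner_smul_right_eq_smul,
    inner_smul_right, Complex.real_smul, Complex.ofReal_mul, ← inner_conj_symm, RCLike.conj_mul,
    Complex.ofReal_pow]
  rfl

/-! ### Measurement in the displaced squeezed states. -/

theorem trace_rankOne (u v : Modes 2) : trace (rankOne ℂ u v) = inner ℂ v u := by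
  simp only [trace, rankOne_apply, inner_smul_right]
  exact HilbertBasis.tsum_inner_mul_inner _ _ _

/-- The covariance matrix of the two-mode squeezed vacuum. -/
def squeezedCov (s : ℝ) : Matrix (Fin 4) (Fin 4) ℝ :=
  !![Real.cosh (2 * s), 0, Real.sinh (2 * s), 0; 0, Real.cosh (2 * s), 0, -Real.sinh (2 * s);
    Real.sinh (2 * s), 0, Real.cosh (2 * s), 0; 0, -Real.sinh (2 * s), 0, Real.cosh (2 * s)]

theorem isCenteredGaussianState_squeezedVacuum (s : ℝ) :
    IsCenteredGaussianState (rankOne ℂ (squeezedVacuum s) (squeezedVacuum s)) (squeezedCov s) := by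
  refine ⟨isPositive_rankOne_self _, ?_, ?_, fun ξ => ?_⟩
  · rw [trace_rankOne, inner_self_eq_norm_sq_to_K, norm_squeezedVacuum]
    norm_num
  · ext i j
    fin_cases i <;> fin_cases j <;> rfl
  · rw [rankOne_comp, trace_rankOne, ContinuousLinearMap.adjoint_inner_left,
      inner_squeezedVacuum_displacement]
    congr 3
    simp [squeezedForm, squeezedCov, Omega, Matrix.mulVec, dotProduct, Fin.sum_univ_four]
    ring

theorem trace_povmElement_comp (s : ℝ) (y : Fin 4 → ℝ) (R : Op) :
    trace (povmElement (rankOne ℂ (squeezedVacuum s) (squeezedVacuum s)) y ∘L R) =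
      (1 / Real.pi ^ 2 : ℝ) * inner ℂ (state s y) (R (state s y)) := by
  have h : povmElement (rankOne ℂ (squeezedVacuum s) (squeezedVacuum s)) y =
      rankOne ℂ (((1 / Real.pi ^ 2 : ℝ) : ℂ) • state s y) (state s y) := by
    have := rho_eq s y
    rw [rho] at this
    rw [povmElement, this, map_smul, _root_.smul_apply]
    rfl
  rw [h, rankOne_comp, trace_rankOne, inner_smul_right, ContinuousLinearMap.adjoint_inner_left]

/-- The density of the outcome error of the measurement in the displaced squeezed states. -/
def errorDensity (s : ℝ) (x : Fin 4 → ℝ) : ℝ := 1 / Real.pi ^ 2 * Real.exp (-squeezedForm s x)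

theorem re_trace_povmElement_comp {σ : ℝ} (hσ : 0 < σ) (s : ℝ) (y : Fin 4 → ℝ)
    (A : Set (Fin 4 → ℝ)) :
    (trace (povmElement (rankOne ℂ (squeezedVacuum s) (squeezedVacuum s)) y ∘L
      ((2 : ℝ) • ∫ r in A, prior σ r • rho s r))).re =
        2 * ∫ r in A, prior σ r * errorDensity s (y - r) := by
  rw [trace_povmElement_comp, _root_.smul_apply, inner_smul_right_eq_smul,
    inner_setIntegral_rho hσ, Complex.real_smul, ← Complex.ofReal_mul, ← Complex.ofReal_mul,
    Complex.ofReal_re, mul_left_comm, ← integral_const_mul]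
  congr 2 with r
  have : squeezedForm s (r - y) = squeezedForm s (y - r) := by
    simp only [squeezedForm, Pi.sub_apply]; ring
  rw [norm_inner_state, errorDensity, this]
  ring

/-- The linear change of variables which turns the outcome error into a standard Gaussian. -/
def errorMatrix (s : ℝ) : Matrix (Fin 4) (Fin 4) ℝ :=
  !![Real.exp (-s) / 2, 0, Real.exp s / 2, 0; 0, Real.exp (-s) / 2, 0, Real.exp s / 2;
    -(Real.exp (-s) / 2), 0, Real.exp s / 2, 0; 0, Real.exp (-s) / 2, 0, -(Real.exp s / 2)]

theorem abs_det_errorMatrix (s : ℝ) : |(errorMatrix s).det| = 1 / 4 := by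
  have h : Real.exp (-s) * Real.exp s = 1 := by rw [← Real.exp_add]; simp
  have : (errorMatrix s).det = -(1 / 4) := by
    simp [errorMatrix, Matrix.det_succ_row_zero, Fin.sum_univ_succ, Fin.succAbove]
    linear_combination (-(1 / 4) * (Real.exp (-s) * Real.exp s + 1)) * h
  rw [this]
  norm_num

/-- In the coordinates `a - c = e^{-s} z₀`, `b + d = e^{-s} z₁`, `a + c = e^s z₂`, `b - d = e^s z₃`
the form becomes `|z|² / 2`. The factor `4` is the inverse of the Jacobian. -/
theorem errorDensity_errorMatrix (s : ℝ) (z : Fin 4 → ℝ) :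
    errorDensity s (Matrix.toLin' (errorMatrix s) z) = 4 * prior 1 z := by
  have h : Real.exp (-s) * Real.exp s = 1 := by rw [← Real.exp_add]; simp
  have h1 : Real.exp (2 * s) = Real.exp s ^ 2 := by rw [← Real.exp_nat_mul]; simp
  have h2 : Real.exp (-(2 * s)) = Real.exp (-s) ^ 2 := by rw [← Real.exp_nat_mul]; simp
  rw [errorDensity, prior, ← mul_assoc]
  congr 1
  · field_simp
  congr 1
  simp only [squeezedForm, errorMatrix, Matrix.toLin'_apply, Matrix.mulVec, dotProduct,
    Fin.sum_univ_four, Real.cosh_eq, Real.sinh_eq, h1, h2]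
  simp
  generalize Real.exp (-s) = p at *
  generalize Real.exp s = q at *
  grind

theorem alpha_add_errorMatrix (s : ℝ) (r z : Fin 4 → ℝ) :
    alpha (r + Matrix.toLin' (errorMatrix s) z) =
      (r 0 - r 2 + Real.exp (-s) * z 0) * (r 1 + r 3 + Real.exp (-s) * z 1) := by
  simp only [alpha, Pi.add_apply, errorMatrix, Matrix.toLin'_apply, Matrix.mulVec, dotProduct,
    Fin.sum_univ_four]
  simp
  ring

theorem map_errorMatrix (s : ℝ) :
    Measure.map (Matrix.toLin' (errorMatrix s)) volume =
      (4 : ℝ≥0∞) • (volume : Measure (Fin 4 → ℝ)) := by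
  have h := abs_det_errorMatrix s
  rw [Real.map_matrix_volume_pi_eq_smul_volume_pi fun h0 => by simp [h0] at h, abs_inv, h]
  norm_num

theorem measurable_errorMatrix (s : ℝ) : Measurable (Matrix.toLin' (errorMatrix s)) :=
  (LinearMap.continuous_of_finiteDimensional _).measurable

theorem continuous_errorDensity (s : ℝ) : Continuous (errorDensity s) := by
  unfold errorDensity squeezedForm; fun_prop

theorem integral_errorDensity_mul (s : ℝ) {f : (Fin 4 → ℝ) → ℝ} (hf : Measurable f)
    (r : Fin 4 → ℝ) : ∫ y, f y * errorDensity s (y - r) =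
      ∫ z, f (r + Matrix.toLin' (errorMatrix s) z) * prior 1 z := by
  have h1 := integral_map (measurable_errorMatrix s).aemeasurable (μ := volume)
    (f := fun w => f (r + w) * errorDensity s w) (((hf.comp (measurable_const_add r)).mul
      (continuous_errorDensity s).measurable).aestronglyMeasurable)
  rw [map_errorMatrix, integral_smul_measure] at h1
  simp_rw [errorDensity_errorMatrix, mul_left_comm _ (4 : ℝ), integral_const_mul] at h1
  rw [← integral_add_left_eq_self _ r]
  simp only [add_sub_cancel_left]
  simpa using h1

theorem integrable_errorDensity (s : ℝ) : Integrable (errorDensity s) := by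
  rw [← integrable_smul_measure (c := 4) (by norm_num) (by norm_num), ← map_errorMatrix s,
    integrable_map_measure (continuous_errorDensity s).aestronglyMeasurable
      (measurable_errorMatrix s).aemeasurable]
  exact ((integrable_prior one_pos).const_mul 4).congr
    (Eventually.of_forall fun z => (errorDensity_errorMatrix s z).symm)

/-! ### The probability of a correct guess and its limit. -/

theorem ae_alpha_ne_zero : ∀ᵐ r : Fin 4 → ℝ, alpha r ≠ 0 := by
  have key : ∀ (L : (Fin 4 → ℝ) →ₗ[ℝ] ℝ) (x : Fin 4 → ℝ), L x ≠ 0 → ∀ᵐ r, L r ≠ 0 := by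
    intro L x hx
    refine measure_mono_null (t := (LinearMap.ker L : Set (Fin 4 → ℝ))) (fun r hr => ?_)
      (Measure.addHaar_submodule volume _ fun h => hx ?_)
    · simpa using hr
    · exact LinearMap.mem_ker.1 (h ▸ Submodule.mem_top)
  filter_upwards [key (LinearMap.proj (R := ℝ) (φ := fun _ => ℝ) 0 - LinearMap.proj 2) ![1, 0, 0, 0]
      (by simp),
    key (LinearMap.proj (R := ℝ) (φ := fun _ => ℝ) 1 + LinearMap.proj 3) ![0, 1, 0, 0]
      (by simp)] with r h0 h1
  exact mul_ne_zero (show r 0 - r 2 ≠ 0 from h0) (show r 1 + r 3 ≠ 0 from h1)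

theorem continuous_alpha : Continuous alpha := by unfold alpha; fun_prop

/-- The indicator of the event that the guess of the sign of `alpha r` from the outcome `y` is
correct. -/
def correct (y r : Fin 4 → ℝ) : ℝ :=
  {y | 0 < alpha y}.indicator 1 y * {r | 0 < alpha r}.indicator 1 r +
    {y | 0 < alpha y}ᶜ.indicator 1 y * {r | alpha r < 0}.indicator 1 r

theorem measurable_correct : Measurable (Function.uncurry correct) := by
  have hp : MeasurableSet {y : Fin 4 → ℝ | 0 < alpha y} :=
    measurableSet_lt measurable_const continuous_alpha.measurable
  have hm : MeasurableSet {y : Fin 4 → ℝ | alpha y < 0} :=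
    measurableSet_lt continuous_alpha.measurable measurable_const
  exact (((measurable_one.indicator hp).comp measurable_fst).mul
    ((measurable_one.indicator hp).comp measurable_snd)).add
    (((measurable_one.indicator hp.compl).comp measurable_fst).mul
    ((measurable_one.indicator hm).comp measurable_snd))

theorem correct_mem (y r : Fin 4 → ℝ) : correct y r = 0 ∨ correct y r = 1 := by
  by_cases h1 : 0 < alpha y <;> by_cases h2 : 0 < alpha r <;> by_cases h3 : alpha r < 0 <;>
    simp [correct, h1, h2, h3]

theorem norm_correct_le (y r : Fin 4 → ℝ) : ‖correct y r‖ ≤ 1 := by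
  rcases correct_mem y r with h | h <;> simp [h]

theorem correct_eq_one {y r : Fin 4 → ℝ} (h : 0 < alpha y * alpha r) : correct y r = 1 := by
  rcases pos_and_pos_or_neg_and_neg_of_mul_pos h with ⟨h1, h2⟩ | ⟨h1, h2⟩
  · simp [correct, h1, h2]
  · simp [correct, h1.le, h2]

/-- Writing the outcome as `r + errorMatrix s z` makes the measure independent of `s`, which then
occurs only inside a bounded indicator; dominated convergence becomes available. -/
theorem gaussianSuccess_eq {σ : ℝ} (hσ : 0 < σ) (s : ℝ) :
    gaussianSuccess σ s (rankOne ℂ (squeezedVacuum s) (squeezedVacuum s)) {y | 0 < alpha y} =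
      ∫ r, ∫ z, correct (r + Matrix.toLin' (errorMatrix s) z) r * (prior σ r * prior 1 z) := by
  have hp : MeasurableSet {y : Fin 4 → ℝ | 0 < alpha y} :=
    measurableSet_lt measurable_const continuous_alpha.measurable
  have hm : MeasurableSet {y : Fin 4 → ℝ | alpha y < 0} :=
    measurableSet_lt continuous_alpha.measurable measurable_const
  have hI : Integrable (fun p : (Fin 4 → ℝ) × (Fin 4 → ℝ) =>
      prior σ p.2 * errorDensity s (p.1 - p.2)) (volume.prod volume) :=
    (integrable_prior hσ).convolution_integrand (ContinuousLinearMap.mul ℝ ℝ)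
      (integrable_errorDensity s)
  have hJ : ∀ A B : Set (Fin 4 → ℝ), MeasurableSet A → MeasurableSet B →
      Integrable (fun p : (Fin 4 → ℝ) × (Fin 4 → ℝ) => (A.indicator 1 p.1 * B.indicator 1 p.2) *
        (prior σ p.2 * errorDensity s (p.1 - p.2))) (volume.prod volume) := by
    intro A B hA hB
    refine hI.bdd_mul (c := 1) (((measurable_one.indicator hA).comp measurable_fst).mul
      ((measurable_one.indicator hB).comp measurable_snd)).aestronglyMeasurable
      (Eventually.of_forall fun p => ?_)
    by_cases h1 : p.1 ∈ A <;> by_cases h2 : p.2 ∈ B <;> simp [h1, h2]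
  have hK : ∀ A B : Set (Fin 4 → ℝ), MeasurableSet A → MeasurableSet B →
      ∫ y in A, (trace (povmElement (rankOne ℂ (squeezedVacuum s) (squeezedVacuum s)) y ∘L
        ((2 : ℝ) • ∫ r in B, prior σ r • rho s r))).re =
      2 * ∫ p : (Fin 4 → ℝ) × (Fin 4 → ℝ), (A.indicator 1 p.1 * B.indicator 1 p.2) *
        (prior σ p.2 * errorDensity s (p.1 - p.2)) ∂(volume.prod volume) := by
    intro A B hA hB
    rw [integral_prod _ (hJ A B hA hB), ← integral_const_mul, ← integral_indicator hA]
    congr 1 with y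
    by_cases h : y ∈ A
    · rw [Set.indicator_of_mem h]
      rw [re_trace_povmElement_comp hσ, ← integral_indicator hB]
      congr 2 with r
      by_cases h2 : r ∈ B <;> simp [h, h2]
    · simp [h]
  rw [gaussianSuccess, rhoPlus, rhoMinus, hK _ _ hp hp, hK _ _ hp.compl hm, ← mul_add,
    ← integral_add (hJ _ _ hp hp) (hJ _ _ hp.compl hm), ← mul_assoc, one_div,
    inv_mul_cancel₀ two_ne_zero, one_mul]
  have hsymm := integral_prod_symm _ ((hJ _ _ hp hp).add (hJ _ _ hp.compl hm))
  simp only [Pi.add_apply] at hsymm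
  rw [hsymm]
  congr 1 with r
  have := integral_errorDensity_mul s (f := fun y => correct y r)
    (measurable_correct.comp measurable_prodMk_right) r
  simp_rw [mul_left_comm _ (prior σ r), integral_const_mul, ← this, ← integral_const_mul]
  congr 1 with y
  simp only [correct]
  ring

theorem tendsto_gaussianSuccess {σ : ℝ} (hσ : 0 < σ) :
    Tendsto (fun s => gaussianSuccess σ s (rankOne ℂ (squeezedVacuum s) (squeezedVacuum s))
      {y | 0 < alpha y}) atTop (𝓝 1) := by
  have hmeas : ∀ s, AEStronglyMeasurable (fun p : (Fin 4 → ℝ) × (Fin 4 → ℝ) =>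
      correct (p.1 + Matrix.toLin' (errorMatrix s) p.2) p.1) (volume.prod volume) := fun s =>
    (measurable_correct.comp ((measurable_fst.add ((measurable_errorMatrix s).comp
      measurable_snd)).prodMk measurable_fst)).aestronglyMeasurable
  have hI : Integrable (fun p : (Fin 4 → ℝ) × (Fin 4 → ℝ) => prior σ p.1 * prior 1 p.2)
      (volume.prod volume) := (integrable_prior hσ).mul_prod (integrable_prior one_pos)
  have hint : ∀ s, Integrable (fun p : (Fin 4 → ℝ) × (Fin 4 → ℝ) =>
      correct (p.1 + Matrix.toLin' (errorMatrix s) p.2) p.1 * (prior σ p.1 * prior 1 p.2))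
      (volume.prod volume) := fun s =>
    hI.bdd_mul (c := 1) (hmeas s) (Eventually.of_forall fun p => norm_correct_le _ _)
  simp_rw [gaussianSuccess_eq hσ]
  have hs : ∀ s, ∫ r, ∫ z, correct (r + Matrix.toLin' (errorMatrix s) z) r *
      (prior σ r * prior 1 z) = ∫ p : (Fin 4 → ℝ) × (Fin 4 → ℝ),
        correct (p.1 + Matrix.toLin' (errorMatrix s) p.2) p.1 * (prior σ p.1 * prior 1 p.2)
          ∂(volume.prod volume) := fun s => (integral_prod _ (hint s)).symm
  simp_rw [hs]
  have hone : ∫ p : (Fin 4 → ℝ) × (Fin 4 → ℝ), prior σ p.1 * prior 1 p.2 ∂(volume.prod volume)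
      = 1 := by
    rw [integral_prod_mul, integral_prior hσ, integral_prior one_pos, one_mul]
  suffices h : Tendsto (fun s => ∫ p : (Fin 4 → ℝ) × (Fin 4 → ℝ),
      correct (p.1 + Matrix.toLin' (errorMatrix s) p.2) p.1 * (prior σ p.1 * prior 1 p.2)
        ∂(volume.prod volume)) atTop (𝓝 (∫ p : (Fin 4 → ℝ) × (Fin 4 → ℝ),
        prior σ p.1 * prior 1 p.2 ∂(volume.prod volume))) by rwa [hone] at h
  refine tendsto_integral_filter_of_dominated_convergence _
    (Eventually.of_forall fun s => (hint s).aestronglyMeasurable)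
    (Eventually.of_forall fun s => Eventually.of_forall fun p => ?_) hI ?_
  · rw [norm_mul, Real.norm_of_nonneg (mul_pos (prior_pos hσ _) (prior_pos one_pos _)).le]
    exact mul_le_of_le_one_left (mul_pos (prior_pos hσ _) (prior_pos one_pos _)).le
      (norm_correct_le _ _)
  · have hne : ∀ᵐ p : (Fin 4 → ℝ) × (Fin 4 → ℝ) ∂(volume.prod volume), alpha p.1 ≠ 0 :=
      Measure.quasiMeasurePreserving_fst.ae ae_alpha_ne_zero
    filter_upwards [hne] with p hp
    -- The integrand is eventually constant: once the error is small, `alpha` of the outcome has the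
    -- sign of `alpha p.1`.
    refine tendsto_const_nhds.congr' ?_
    have hexp : Tendsto (fun s : ℝ => Real.exp (-s)) atTop (𝓝 0) :=
      Real.tendsto_exp_neg_atTop_nhds_zero
    have hlim : Tendsto (fun s => alpha (p.1 + Matrix.toLin' (errorMatrix s) p.2) * alpha p.1)
        atTop (𝓝 (alpha p.1 * alpha p.1)) := by
      simp_rw [alpha_add_errorMatrix]
      have := ((((hexp.mul_const (p.2 0)).const_add (p.1 0 - p.1 2)).mul
        ((hexp.mul_const (p.2 1)).const_add (p.1 1 + p.1 3))).mul_const (alpha p.1))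
      simpa [alpha] using this
    filter_upwards [hlim.eventually (lt_mem_nhds (mul_self_pos.2 hp))] with s hs
    rw [correct_eq_one hs, one_mul]

/-! ### Tensor products of vectors -/

theorem prodVec_ae (f g : Modes 1) :
    prodVec f g =ᵐ[volume] fun x => f (fun _ => x 0) * g (fun _ => x 1) :=
  (memLp_prodVec f g).coeFn_toLp

theorem quasiMeasurePreserving_const_eval (i : Fin 2) :
    Measure.QuasiMeasurePreserving (fun (x : Fin 2 → ℝ) (_ : Fin 1) => x i) :=
  (volume_preserving_funUnique (Fin 1) ℝ).symm.quasiMeasurePreserving.comp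
    (Measure.quasiMeasurePreserving_eval _ i)

theorem prodVec_add_left (f f' g : Modes 1) :
    prodVec (f + f') g = prodVec f g + prodVec f' g := by
  refine Lp.ext ?_
  filter_upwards [prodVec_ae (f + f') g, prodVec_ae f g, prodVec_ae f' g,
    Lp.coeFn_add (prodVec f g) (prodVec f' g),
    (quasiMeasurePreserving_const_eval 0).ae (Lp.coeFn_add f f')] with x h1 h2 h3 h4 h5
  rw [h1, h4, Pi.add_apply, h2, h3, h5, Pi.add_apply, add_mul]

theorem prodVec_add_right (f g g' : Modes 1) :
    prodVec f (g + g') = prodVec f g + prodVec f g' := by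
  refine Lp.ext ?_
  filter_upwards [prodVec_ae f (g + g'), prodVec_ae f g, prodVec_ae f g',
    Lp.coeFn_add (prodVec f g) (prodVec f g'),
    (quasiMeasurePreserving_const_eval 1).ae (Lp.coeFn_add g g')] with x h1 h2 h3 h4 h5
  rw [h1, h4, Pi.add_apply, h2, h3, h5, Pi.add_apply, mul_add]

theorem prodVec_smul_left (c : ℂ) (f g : Modes 1) : prodVec (c • f) g = c • prodVec f g := by
  refine Lp.ext ?_
  filter_upwards [prodVec_ae (c • f) g, prodVec_ae f g, Lp.coeFn_smul c (prodVec f g),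
    (quasiMeasurePreserving_const_eval 0).ae (Lp.coeFn_smul c f)] with x h1 h2 h3 h4
  rw [h1, h3, Pi.smul_apply, h2, h4, Pi.smul_apply, smul_eq_mul, smul_eq_mul, mul_assoc]

theorem prodVec_smul_right (c : ℂ) (f g : Modes 1) : prodVec f (c • g) = c • prodVec f g := by
  refine Lp.ext ?_
  filter_upwards [prodVec_ae f (c • g), prodVec_ae f g, Lp.coeFn_smul c (prodVec f g),
    (quasiMeasurePreserving_const_eval 1).ae (Lp.coeFn_smul c g)] with x h1 h2 h3 h4
  rw [h1, h3, Pi.smul_apply, h2, h4, Pi.smul_apply, smul_eq_mul, smul_eq_mul, mul_left_comm]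

theorem inner_prodVec (f g f' g' : Modes 1) :
    inner ℂ (prodVec f g) (prodVec f' g') = inner ℂ f f' * inner ℂ g g' := by
  have key : ∀ F : (Fin 1 → ℝ) → ℂ, ∫ t : ℝ, F (fun _ => t) = ∫ x, F x := fun F =>
    (volume_preserving_funUnique (Fin 1) ℝ).symm.integral_comp' F
  let G : Fin 2 → ℝ → ℂ := ![fun t => inner ℂ (f fun _ => t) (f' fun _ => t),
    fun t => inner ℂ (g fun _ => t) (g' fun _ => t)]
  have h : (fun x => inner ℂ (prodVec f g x) (prodVec f' g' x)) =ᵐ[volume]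
      fun x : Fin 2 → ℝ => ∏ i, G i (x i) := by
    filter_upwards [prodVec_ae f g, prodVec_ae f' g'] with x h1 h2
    rw [h1, h2, Fin.prod_univ_two]
    simp only [G, RCLike.inner_apply, map_mul, Matrix.cons_val_zero, Matrix.cons_val_one]
    ring
  rw [L2.inner_def, integral_congr_ae h, integral_fintype_prod_volume_eq_prod, Fin.prod_univ_two,
    L2.inner_def, L2.inner_def]
  exact congr_arg₂ _ (key fun x => inner ℂ (f x) (f' x)) (key fun x => inner ℂ (g x) (g' x))

theorem norm_prodVec (f g : Modes 1) : ‖prodVec f g‖ = ‖f‖ * ‖g‖ := by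
  have h := inner_prodVec f g f g
  simp only [inner_self_eq_norm_sq_to_K] at h
  have h' : ‖prodVec f g‖ ^ 2 = (‖f‖ * ‖g‖) ^ 2 :=
    Complex.ofReal_injective (by push_cast; rw [mul_pow]; exact h)
  exact (pow_left_inj₀ (norm_nonneg _) (by positivity) two_ne_zero).1 h'

/-- The operator `f ↦ f ⊗ g`. -/
def tensRight (g : Modes 1) : Modes 1 →L[ℂ] Modes 2 :=
  LinearMap.mkContinuous ⟨⟨fun f => prodVec f g, fun f f' => prodVec_add_left f f' g⟩,
    fun c f => prodVec_smul_left c f g⟩ ‖g‖ fun f => by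
      rw [mul_comm]; exact (norm_prodVec f g).le

/-- The operator `g ↦ f ⊗ g`. -/
def tensLeft (f : Modes 1) : Modes 1 →L[ℂ] Modes 2 :=
  LinearMap.mkContinuous ⟨⟨fun g => prodVec f g, fun g g' => prodVec_add_right f g g'⟩,
    fun c g => prodVec_smul_right c f g⟩ ‖f‖ fun g => (norm_prodVec f g).le

/-- The adjoint of `tensRight g` is the partial inner product with `g`. It reduces local operations
on a two-mode vector to operators on one-mode vectors, with no tensor product of operators needed.
-/
theorem inner_prodVec_tensRight (f g : Modes 1) (ψ : Modes 2) :
    inner ℂ (prodVec f g) ψ = inner ℂ f (ContinuousLinearMap.adjoint (tensRight g) ψ) := by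
  rw [ContinuousLinearMap.adjoint_inner_right]; rfl

theorem inner_prodVec_tensLeft (f g : Modes 1) (ψ : Modes 2) :
    inner ℂ (prodVec f g) ψ = inner ℂ g (ContinuousLinearMap.adjoint (tensLeft f) ψ) := by
  rw [ContinuousLinearMap.adjoint_inner_right]; rfl

/-! ### Hilbert bases of the mode spaces -/

/-- Orthonormal vectors are at distance `√2 > 1`, so the balls of radius `1/2` are disjoint.
Countability allows sums over a basis to be measured and exchanged with integrals. -/
theorem countable_of_orthonormal {ι E : Type*} [NormedAddCommGroup E] [InnerProductSpace ℂ E]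
    [TopologicalSpace.SeparableSpace E] {v : ι → E} (hv : Orthonormal ℂ v) : Countable ι := by
  refine Pairwise.countable_of_isOpen_disjoint (s := fun i => Metric.ball (v i) (1 / 2))
    (fun i j hij => Metric.ball_disjoint_ball ?_) (fun i => Metric.isOpen_ball)
    fun i => ⟨v i, Metric.mem_ball_self (by norm_num)⟩
  have h : ‖v i - v j‖ ^ 2 = 2 := by
    rw [@norm_sub_sq ℂ, hv.1 i, hv.1 j, hv.2 hij]
    norm_num
  rw [dist_eq_norm]
  nlinarith [norm_nonneg (v i - v j)]

/-- The index set of a Hilbert basis of `Modes n`. -/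
abbrev BasisIndex (n : ℕ) : Set (Modes n) := (exists_hilbertBasis ℂ (Modes n)).choose

/-- A Hilbert basis of `Modes n`. -/
def modeBasis (n : ℕ) : HilbertBasis (BasisIndex n) ℂ (Modes n) :=
  (exists_hilbertBasis ℂ (Modes n)).choose_spec.choose

instance countable_basisIndex (n : ℕ) : Countable (BasisIndex n) :=
  haveI : Fact ((1 : ℝ≥0∞) ≤ 2) := ⟨by norm_num⟩
  haveI : Fact ((2 : ℝ≥0∞) ≠ ∞) := ⟨by norm_num⟩
  countable_of_orthonormal (modeBasis n).orthonormal

theorem enorm_sq_eq_ofReal {E : Type*} [SeminormedAddCommGroup E] (x : E) :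
    ‖x‖ₑ ^ 2 = ENNReal.ofReal (‖x‖ ^ 2) := by
  rw [ENNReal.ofReal_pow (norm_nonneg _), ofReal_norm]

theorem tsum_enorm_inner_sq {ι E : Type*} [NormedAddCommGroup E] [InnerProductSpace ℂ E]
    (b : HilbertBasis ι ℂ E) (x : E) : ∑' i, ‖inner ℂ (b i) x‖ₑ ^ 2 = ‖x‖ₑ ^ 2 := by
  have h : HasSum (fun i => ‖inner ℂ (b i) x‖ ^ 2) (‖x‖ ^ 2) := by
    have := Complex.reCLM.hasSum (b.hasSum_inner_mul_inner x x)
    rw [inner_self_eq_norm_sq_to_K] at this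
    convert this using 1
    · funext i
      rw [← inner_conj_symm x, RCLike.conj_mul, Complex.reCLM_apply]
      norm_cast
    · rw [Complex.reCLM_apply]
      norm_cast
  simp_rw [enorm_sq_eq_ofReal]
  rw [← h.tsum_eq, ENNReal.ofReal_tsum_of_nonneg (fun i => by positivity) h.summable]

/-! ### The weight of a branch of a protocol -/

/-- The squared norm of `(KA ⊗ KB) ψ`. -/
def branchWeight {m n : ℕ} (KA : Modes 1 →L[ℂ] Modes m) (KB : Modes 1 →L[ℂ] Modes n)
    (ψ : Modes 2) : ℝ≥0∞ :=
  ∑' (i : BasisIndex m) (j : BasisIndex n),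
    ‖inner ℂ (prodVec (ContinuousLinearMap.adjoint KA (modeBasis m i))
      (ContinuousLinearMap.adjoint KB (modeBasis n j))) ψ‖ₑ ^ 2

/-- Parseval on Alice's side alone leaves `KA` applied to a vector, the form in which completeness
of her next instrument can be used. -/
theorem branchWeight_eq_left {m n : ℕ} (KA : Modes 1 →L[ℂ] Modes m) (KB : Modes 1 →L[ℂ] Modes n)
    (ψ : Modes 2) : branchWeight KA KB ψ = ∑' j : BasisIndex n,
      ‖KA (ContinuousLinearMap.adjoint
        (tensRight (ContinuousLinearMap.adjoint KB (modeBasis n j))) ψ)‖ₑ ^ 2 := by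
  rw [branchWeight, ENNReal.tsum_comm]
  congr 1 with j
  simp_rw [inner_prodVec_tensRight, ContinuousLinearMap.adjoint_inner_left]
  exact tsum_enorm_inner_sq _ _

theorem branchWeight_eq_right {m n : ℕ} (KA : Modes 1 →L[ℂ] Modes m) (KB : Modes 1 →L[ℂ] Modes n)
    (ψ : Modes 2) : branchWeight KA KB ψ = ∑' i : BasisIndex m,
      ‖KB (ContinuousLinearMap.adjoint
        (tensLeft (ContinuousLinearMap.adjoint KA (modeBasis m i))) ψ)‖ₑ ^ 2 := by
  rw [branchWeight]
  congr 1 with i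
  simp_rw [inner_prodVec_tensLeft, ContinuousLinearMap.adjoint_inner_left]
  exact tsum_enorm_inner_sq _ _

/-- Only an upper bound is needed, so Bessel's inequality for the orthonormal product vectors
suffices. -/
theorem branchWeight_id_le (ψ : Modes 2) :
    branchWeight (ContinuousLinearMap.id ℂ (Modes 1)) (ContinuousLinearMap.id ℂ (Modes 1)) ψ ≤
      ‖ψ‖ₑ ^ 2 := by
  have hon : Orthonormal ℂ fun p : BasisIndex 1 × BasisIndex 1 =>
      prodVec (modeBasis 1 p.1) (modeBasis 1 p.2) := by
    classical
    rw [orthonormal_iff_ite]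
    intro p q
    rw [inner_prodVec, orthonormal_iff_ite.1 (modeBasis 1).orthonormal,
      orthonormal_iff_ite.1 (modeBasis 1).orthonormal]
    by_cases h1 : p.1 = q.1 <;> by_cases h2 : p.2 = q.2 <;> simp [h1, h2, Prod.ext_iff]
  simp only [branchWeight, ContinuousLinearMap.adjoint_id, ContinuousLinearMap.id_apply]
  rw [← ENNReal.tsum_prod (f := fun i j => ‖inner ℂ (prodVec (modeBasis 1 i) (modeBasis 1 j)) ψ‖ₑ ^ 2),
    ENNReal.tsum_eq_iSup_sum]
  refine iSup_le fun t => ?_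
  simp_rw [enorm_sq_eq_ofReal]
  rw [← ENNReal.ofReal_sum_of_nonneg fun _ _ => by positivity]
  exact ENNReal.ofReal_le_ofReal (hon.sum_inner_products_le ψ)

theorem norm_unitVec : ‖unitVec‖ = 1 := by
  have h : (volume : Measure (Fin 0 → ℝ)) Set.univ = 1 := by
    rw [volume_pi, Measure.pi_univ]; simp
  rw [unitVec, Lp.norm_toLp, eLpNorm_const _ (by norm_num) (fun h0 => by simp [h0] at h), h]
  simp

theorem enorm_inner_unitVec_le (x : Modes 0) : ‖inner ℂ unitVec x‖ₑ ^ 2 ≤ ‖x‖ₑ ^ 2 := by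
  rw [enorm_sq_eq_ofReal, enorm_sq_eq_ofReal]
  refine ENNReal.ofReal_le_ofReal (pow_le_pow_left₀ (norm_nonneg _) ?_ 2)
  simpa [norm_unitVec] using norm_inner_le_norm (𝕜 := ℂ) unitVec x

theorem enorm_inner_le_branchWeight (KA KB : Modes 1 →L[ℂ] Modes 0) (ψ : Modes 2) :
    ‖inner ℂ (prodVec (ContinuousLinearMap.adjoint KA unitVec)
      (ContinuousLinearMap.adjoint KB unitVec)) ψ‖ₑ ^ 2 ≤ branchWeight KA KB ψ := by
  rw [inner_prodVec_tensLeft, ContinuousLinearMap.adjoint_inner_left, branchWeight_eq_left]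
  refine (enorm_inner_unitVec_le _).trans ?_
  rw [← tsum_enorm_inner_sq (modeBasis 0)]
  refine ENNReal.tsum_le_tsum fun j => ?_
  rw [← ContinuousLinearMap.adjoint_inner_left, ← inner_prodVec_tensLeft, inner_prodVec_tensRight,
    ContinuousLinearMap.adjoint_inner_left]
  exact enorm_inner_unitVec_le _

/-! ### Conservation of weight along a protocol -/

theorem measurable_enorm_sq_instrument {m n : ℕ} {X : Type} [MeasurableSpace X] {μ : Measure X}
    {L : X → Modes m →L[ℂ] Modes n} (hL : IsGaussianInstrument μ L) {v : (Fin 4 → ℝ) → Modes m}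
    (hv : Continuous v) :
    Measurable fun p : X × (Fin 4 → ℝ) => ‖L p.1 (v p.2)‖ₑ ^ 2 := by
  have h := stronglyMeasurable_uncurry_of_continuous_of_stronglyMeasurable
    (u := fun r x => L x (v r)) (fun x => (L x).continuous.comp hv) fun r => hL.measurable (v r)
  exact (h.enorm.comp measurable_swap).pow_const 2

theorem lintegral_enorm_sq_instrument {m n : ℕ} {X : Type} [MeasurableSpace X] {μ : Measure X}
    {L : X → Modes m →L[ℂ] Modes n} (hL : IsGaussianInstrument μ L) (v : Modes m) :
    ∫⁻ x, ‖L x v‖ₑ ^ 2 ∂μ = ‖v‖ₑ ^ 2 := by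
  simp_rw [enorm_sq_eq_ofReal]
  exact hL.complete v

section BranchWeight

variable {ψ : (Fin 4 → ℝ) → Modes 2} {w : (Fin 4 → ℝ) → ℝ≥0∞}

/-- Tonelli followed by completeness of the instrument: a round by Alice splits the weight among its
outcomes without changing the total. -/
theorem lintegral_branchWeight_left {m m' n : ℕ} (KA : Modes 1 →L[ℂ] Modes m)
    (KB : Modes 1 →L[ℂ] Modes n) {X : Type} [MeasurableSpace X] {μ : Measure X} [SigmaFinite μ]
    {L : X → Modes m →L[ℂ] Modes m'} (hL : IsGaussianInstrument μ L) (hψ : Continuous ψ)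
    (hw : Measurable w) :
    ∫⁻ x, (∫⁻ r, w r * branchWeight (L x ∘L KA) KB (ψ r)) ∂μ =
      ∫⁻ r, w r * branchWeight KA KB (ψ r) := by
  simp_rw [branchWeight_eq_left, ContinuousLinearMap.comp_apply]
  have hv : ∀ g, Continuous fun r => KA (ContinuousLinearMap.adjoint (tensRight g) (ψ r)) :=
    fun g => KA.continuous.comp ((ContinuousLinearMap.continuous _).comp hψ)
  rw [lintegral_lintegral_swap ((hw.comp measurable_snd).mul (Measurable.tsum fun j =>
    measurable_enorm_sq_instrument hL (hv _))).aemeasurable]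
  congr 1 with r
  have hm : ∀ v, Measurable fun x => ‖L x v‖ₑ ^ 2 := fun v => (hL.measurable v).enorm.pow_const 2
  rw [lintegral_const_mul _ (Measurable.tsum fun j => hm _),
    lintegral_tsum fun j => (hm _).aemeasurable]
  simp_rw [lintegral_enorm_sq_instrument hL]

theorem lintegral_branchWeight_right {m n n' : ℕ} (KA : Modes 1 →L[ℂ] Modes m)
    (KB : Modes 1 →L[ℂ] Modes n) {X : Type} [MeasurableSpace X] {μ : Measure X} [SigmaFinite μ]
    {L : X → Modes n →L[ℂ] Modes n'} (hL : IsGaussianInstrument μ L) (hψ : Continuous ψ)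
    (hw : Measurable w) :
    ∫⁻ x, (∫⁻ r, w r * branchWeight KA (L x ∘L KB) (ψ r)) ∂μ =
      ∫⁻ r, w r * branchWeight KA KB (ψ r) := by
  simp_rw [branchWeight_eq_right, ContinuousLinearMap.comp_apply]
  have hv : ∀ g, Continuous fun r => KB (ContinuousLinearMap.adjoint (tensLeft g) (ψ r)) :=
    fun g => KB.continuous.comp ((ContinuousLinearMap.continuous _).comp hψ)
  rw [lintegral_lintegral_swap ((hw.comp measurable_snd).mul (Measurable.tsum fun j =>
    measurable_enorm_sq_instrument hL (hv _))).aemeasurable]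
  congr 1 with r
  have hm : ∀ v, Measurable fun x => ‖L x v‖ₑ ^ 2 := fun v => (hL.measurable v).enorm.pow_const 2
  rw [lintegral_const_mul _ (Measurable.tsum fun j => hm _),
    lintegral_tsum fun j => (hm _).aemeasurable]
  simp_rw [lintegral_enorm_sq_instrument hL]

end BranchWeight

/-- The adjoint of `K` maps pure Gaussian vectors to pure Gaussian vectors or to `0`. -/
def AdjointGaussian {m n : ℕ} (K : Modes m →L[ℂ] Modes n) : Prop :=
  ∀ f, IsGaussianVec f → ContinuousLinearMap.adjoint K f = 0 ∨
    IsGaussianVec (ContinuousLinearMap.adjoint K f)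

theorem AdjointGaussian.comp {k m n : ℕ} {K : Modes k →L[ℂ] Modes m} (hK : AdjointGaussian K)
    {L : Modes m →L[ℂ] Modes n} (hL : AdjointGaussian L) : AdjointGaussian (L ∘L K) := by
  intro f hf
  rw [ContinuousLinearMap.adjoint_comp, ContinuousLinearMap.comp_apply]
  rcases hL f hf with h | h
  · exact Or.inl (by rw [h, map_zero])
  · exact hK _ h

theorem adjointGaussian_id : AdjointGaussian (ContinuousLinearMap.id ℂ (Modes 1)) := fun f hf =>
  Or.inr (by rwa [ContinuousLinearMap.adjoint_id])

theorem isGaussianVec_unitVec : IsGaussianVec unitVec := by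
  refine ⟨0, 0, 0, Matrix.transpose_zero, ?_, ?_⟩
  · refine Matrix.PosDef.of_dotProduct_mulVec_pos (Subsingleton.elim _ _) fun x hx => ?_
    exact absurd (Subsingleton.elim x 0) hx
  · filter_upwards [memLp_unitVec.coeFn_toLp] with x hx
    rw [unitVec, hx]
    simp

/-- If the weight of each guess in the product Gaussian vectors is dominated by a mixture of the
vectors `ψ r`, then so is the weight of the correct guesses in a protocol. -/
theorem IsGLOCC.le_lintegral_branchWeight {ψ : (Fin 4 → ℝ) → Modes 2}
    {w : (Fin 4 → ℝ) → ℝ≥0∞} (hψ : Continuous ψ) (hw : Measurable w) {R : Bool → Op}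
    (hR : ∀ b, (R b).IsPositive)
    (hle : ∀ (f g : Modes 1), (f = 0 ∨ IsGaussianVec f) → (g = 0 ∨ IsGaussianVec g) → ∀ b,
      ENNReal.ofReal (inner ℂ (prodVec f g) (R b (prodVec f g))).re ≤
        ∫⁻ r, w r * ‖inner ℂ (prodVec f g) (ψ r)‖ₑ ^ 2)
    {m n : ℕ} {KA : Modes 1 →L[ℂ] Modes m} {KB : Modes 1 →L[ℂ] Modes n} {p : Bool → Op → ℝ≥0∞}
    (h : IsGLOCC KA KB p) : AdjointGaussian KA → AdjointGaussian KB →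
      p true (R true) + p false (R false) ≤ ∫⁻ r, w r * branchWeight KA KB (ψ r) := by
  induction h with
  -- At a leaf only the summand of the announced guess is nonzero, so `hle` for that one `b` is
  -- enough.
  | guess KA KB b =>
    intro hA hB
    have h := hle _ _ (hA _ isGaussianVec_unitVec) (hB _ isGaussianVec_unitVec) b
    have h' : ∫⁻ r, w r * ‖inner ℂ (prodVec (ContinuousLinearMap.adjoint KA unitVec)
        (ContinuousLinearMap.adjoint KB unitVec)) (ψ r)‖ₑ ^ 2 ≤
        ∫⁻ r, w r * branchWeight KA KB (ψ r) :=
      lintegral_mono fun r => mul_le_mul_right (enorm_inner_le_branchWeight KA KB (ψ r)) _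
    cases b
    · simpa using h.trans h'
    · simpa using h.trans h'
  | alice KA KB X μ L hL p hp hmeas ih =>
    intro hA hB
    rw [← lintegral_add_left' (hmeas true _ (hR true)),
      ← lintegral_branchWeight_left KA KB hL hψ hw]
    exact lintegral_mono fun x => ih x (hA.comp (hL.gaussian x).2) hB
  | bob KA KB X μ L hL p hp hmeas ih =>
    intro hA hB
    rw [← lintegral_add_left' (hmeas true _ (hR true)),
      ← lintegral_branchWeight_right KA KB hL hψ hw]
    exact lintegral_mono fun x => ih x hA (hB.comp (hL.gaussian x).2)

/-! ### Overlaps of product Gaussian vectors with the displaced squeezed states -/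

theorem IsGaussianVec.exists_ae {f : Modes 1} (hf : IsGaussianVec f) :
    ∃ M v c : ℂ, 0 < M.re ∧
      ∀ᵐ x : Fin 1 → ℝ, f x = Complex.exp (-(1 / 2) * (M * x 0 ^ 2) + v * x 0 + c) := by
  obtain ⟨M, v, c, -, hM, h⟩ := hf
  refine ⟨M 0 0, v 0, c, ?_, ?_⟩
  · simpa using hM.diag_pos (i := 0)
  · filter_upwards [h] with x hx
    rw [hx]
    simp only [dotProduct, Matrix.mulVec, Finset.univ_unique, Fin.default_eq_zero,
      Finset.sum_singleton]
    congr 3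
    ring

theorem re_inv_le {z : ℂ} (hz : 0 < z.re) : (z⁻¹).re ≤ z.re⁻¹ := by
  rw [Complex.inv_re, div_le_iff₀ (Complex.normSq_pos.2 fun h => by simp [h] at hz),
    inv_mul_eq_div, le_div_iff₀ hz, Complex.normSq_apply]
  nlinarith [mul_self_nonneg z.im]

theorem re_inv_pos {z : ℂ} (hz : 0 < z.re) : 0 < (z⁻¹).re := by
  rw [Complex.inv_re]
  exact div_pos hz (Complex.normSq_pos.2 fun h => by simp [h] at hz)

/-- The logarithm of the overlap as a function of the displacement, up to a constant. -/
def overlapExp (C S q P v₀ v₁ k : ℂ) (r : Fin 4 → ℝ) : ℂ :=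
  k - C * (r 0 ^ 2 + r 2 ^ 2) + 2 * S * r 0 * r 2 - (r 0 * r 1 + r 2 * r 3) * Complex.I
    + (v₁ + √2 * (C * r 2 - S * r 0 + r 3 * Complex.I)) ^ 2 / (2 * q)
    + (v₀ + √2 * (C * r 0 - S * r 2 + r 1 * Complex.I)
      + S * (v₁ + √2 * (C * r 2 - S * r 0 + r 3 * Complex.I)) / q) ^ 2 / (2 * P)

/-- The exponent is quadratic in `r`, so the base point and the linear data drop out. Bob's vector
survives only through `C - S ^ 2 / q`, the quadratic coefficient of Alice's conditional wave
function. -/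
theorem overlapExp_second_difference (C S q P v₀ v₁ k : ℂ) (r : Fin 4 → ℝ) (x y t : ℝ) :
    overlapExp C S q P v₀ v₁ k (r + t • ![x, y, 0, 0]) +
      overlapExp C S q P v₀ v₁ k (r - t • ![x, y, 0, 0]) - 2 * overlapExp C S q P v₀ v₁ k r =
    2 * t ^ 2 * (-(C - S ^ 2 / q) * x ^ 2 - x * y * Complex.I
      + ((C - S ^ 2 / q) * x + y * Complex.I) ^ 2 / P) := by
  have h2 : (√2 : ℂ) ^ 2 = 2 := by
    rw [← Complex.ofReal_pow]; norm_num
  simp only [overlapExp, Pi.add_apply, Pi.sub_apply, Pi.smul_apply, smul_eq_mul,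
    Matrix.cons_val_zero, Matrix.cons_val_one, Matrix.cons_val]
  push_cast
  linear_combination (t ^ 2 * (S ^ 2 * x ^ 2 / q + ((C - S ^ 2 / q) * x + y * Complex.I) ^ 2 / P)
    : ℂ) * h2

theorem inner_prodVec_state (s : ℝ) {f g : Modes 1} {M v c N u d : ℂ} (hM : 0 < M.re)
    (hN : 0 < N.re)
    (hf : ∀ᵐ x : Fin 1 → ℝ, f x = Complex.exp (-(1 / 2) * (M * x 0 ^ 2) + v * x 0 + c))
    (hg : ∀ᵐ x : Fin 1 → ℝ, g x = Complex.exp (-(1 / 2) * (N * x 0 ^ 2) + u * x 0 + d)) :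
    ∃ κ q K v₀ v₁ k : ℂ, 0 < q.re ∧ 0 < K.re ∧ K = Real.cosh (2 * s) - Real.sinh (2 * s) ^ 2 / q ∧
      ∀ r, inner ℂ (prodVec f g) (state s r) = κ * Complex.exp (overlapExp (Real.cosh (2 * s))
        (Real.sinh (2 * s)) q (starRingEnd ℂ M + K) v₀ v₁ k r) := by
  have hC := Real.cosh_pos (2 * s)
  have hcs := Real.cosh_sq (2 * s)
  set C := Real.cosh (2 * s) with hCdef
  set S := Real.sinh (2 * s) with hSdef
  have hq : 0 < (starRingEnd ℂ N + C).re := by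
    rw [Complex.add_re, Complex.conj_re, Complex.ofReal_re]; positivity
  -- The real part of the fraction is at most `S² / (Re N + C)`, which is less than `C` as `S² = C²
  -- - 1`.
  have hK : 0 < (C - S ^ 2 / (starRingEnd ℂ N + C) : ℂ).re := by
    have h1 := re_inv_le hq
    have h2 : (S ^ 2 / (starRingEnd ℂ N + C) : ℂ).re = S ^ 2 * ((starRingEnd ℂ N + C)⁻¹).re := by
      rw [div_eq_mul_inv, ← Complex.ofReal_pow, Complex.re_ofReal_mul]
    have h3 : (starRingEnd ℂ N + C).re = N.re + C := by simp
    rw [h3] at h1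
    rw [Complex.sub_re, h2, Complex.ofReal_re, sub_pos]
    refine (mul_le_mul_of_nonneg_left h1 (sq_nonneg S)).trans_lt ?_
    rw [← div_eq_mul_inv, div_lt_iff₀ (by positivity)]
    nlinarith [mul_pos hC hN]
  refine ⟨(√Real.pi : ℂ)⁻¹ * ((Real.pi / ((starRingEnd ℂ N + C) / 2)) ^ (1 / 2 : ℂ) *
    (Real.pi / ((starRingEnd ℂ M + C - (-S) ^ 2 / (starRingEnd ℂ N + C)) / 2)) ^ (1 / 2 : ℂ)),
    starRingEnd ℂ N + C, C - S ^ 2 / (starRingEnd ℂ N + C), starRingEnd ℂ v, starRingEnd ℂ u,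
    starRingEnd ℂ c + starRingEnd ℂ d, hq, hK, rfl, fun r => ?_⟩
  have hae : (fun x => inner ℂ (prodVec f g x) (state s r x)) =ᵐ[volume] fun x =>
      (√Real.pi : ℂ)⁻¹ * Complex.exp (-(1 / 2) * ((starRingEnd ℂ M + C) * x 0 ^ 2
        + 2 * (-S) * x 0 * x 1 + (starRingEnd ℂ N + C) * x 1 ^ 2)
        + (starRingEnd ℂ v + √2 * (C * r 0 - S * r 2 + r 1 * Complex.I)) * x 0
        + (starRingEnd ℂ u + √2 * (C * r 2 - S * r 0 + r 3 * Complex.I)) * x 1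
        + (starRingEnd ℂ c + starRingEnd ℂ d - C * (r 0 ^ 2 + r 2 ^ 2) + 2 * S * r 0 * r 2
          - (r 0 * r 1 + r 2 * r 3) * Complex.I)) := by
    filter_upwards [prodVec_ae f g, displacement_squeezedVacuum_ae s r,
      (quasiMeasurePreserving_const_eval 0).ae hf, (quasiMeasurePreserving_const_eval 1).ae hg]
      with x h1 h2 h3 h4
    rw [state, h1, h2, h3, h4, RCLike.inner_apply, map_mul, ← Complex.exp_conj, ← Complex.exp_conj,
      mul_assoc, ← Complex.exp_add, ← Complex.exp_add]
    congr 2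
    simp only [map_add, map_mul, map_neg, map_div₀, map_one, map_pow, Complex.conj_ofReal,
      map_ofNat]
    ring
  have hpi : (√Real.pi : ℂ)⁻¹ ≠ 0 := by
    have : (√Real.pi : ℂ) ≠ 0 := by exact_mod_cast (Real.sqrt_pos.2 Real.pi_pos).ne'
    simp [this]
  have hI := (L2.integrable_inner (𝕜 := ℂ) (prodVec f g) (state s r)).congr hae
  rw [integrable_const_mul_iff (IsUnit.mk0 _ hpi)] at hI
  have hp : 0 < (starRingEnd ℂ M + C - (-S) ^ 2 / (starRingEnd ℂ N + C)).re := by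
    rw [neg_sq, add_sub_assoc, Complex.add_re, Complex.conj_re]
    exact add_pos hM hK
  rw [L2.inner_def, integral_congr_ae hae, integral_const_mul,
    integral_cexp_quadratic_two hq hp hI, mul_assoc (√Real.pi : ℂ)⁻¹]
  congr 3
  rw [overlapExp, neg_sq, add_sub_assoc (starRingEnd ℂ M)]
  ring

/-- The overlap of a product Gaussian vector with the displaced squeezed states is log-quadratic in
the displacement, and in some direction of Alice's phase plane its curvature is bounded. -/
theorem exists_direction (s : ℝ) {f g : Modes 1} (hf : IsGaussianVec f) (hg : IsGaussianVec g) :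
    ∃ x y : ℝ, (x = 1 ∧ |y| ≤ 1 ∨ |x| ≤ 1 ∧ y = 1) ∧ ∀ (r : Fin 4 → ℝ) (t : ℝ),
      ‖inner ℂ (prodVec f g) (state s r)‖ ^ 2 ≤ Real.exp (2 * t ^ 2) *
        (‖inner ℂ (prodVec f g) (state s (r + t • ![x, y, 0, 0]))‖ *
          ‖inner ℂ (prodVec f g) (state s (r - t • ![x, y, 0, 0]))‖) := by
  obtain ⟨M, v, c, hM, hf⟩ := hf.exists_ae
  obtain ⟨N, u, d, hN, hg⟩ := hg.exists_ae
  obtain ⟨κ, q, K, v₀, v₁, k, hq, hK, hKq, h⟩ := inner_prodVec_state s hM hN hf hg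
  have hP : 0 < (starRingEnd ℂ M + K).re := by
    rw [Complex.add_re, Complex.conj_re]; exact add_pos hM hK
  have hP0 : starRingEnd ℂ M + K ≠ 0 := fun h => by rw [h] at hP; simp at hP
  have key : ∃ x y : ℝ, (x = 1 ∧ |y| ≤ 1 ∨ |x| ≤ 1 ∧ y = 1) ∧
      -1 ≤ (-K * x ^ 2 - x * y * Complex.I
        + (K * x + y * Complex.I) ^ 2 / (starRingEnd ℂ M + K)).re := by
    rcases le_total 1 M.re with h1 | h1
    -- If `f` is narrow in position it is spread in momentum: the curvature in that direction is
    -- `-1/P`, with `Re P ≥ 1`.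
    · refine ⟨0, 1, Or.inr ⟨by simp, rfl⟩, ?_⟩
      have : (-K * (0 : ℝ) ^ 2 - (0 : ℝ) * (1 : ℝ) * Complex.I + (K * (0 : ℝ)
          + (1 : ℝ) * Complex.I) ^ 2 / (starRingEnd ℂ M + K)) = -(starRingEnd ℂ M + K)⁻¹ := by
        push_cast
        rw [mul_zero, zero_add, one_mul, Complex.I_sq]
        ring
      rw [this, Complex.neg_re]
      refine neg_le_neg ((re_inv_le hP).trans (inv_le_one_of_one_le₀ ?_))
      rw [Complex.add_re, Complex.conj_re]
      linarith
    -- If `f` is wide in position, the direction `(1, -Im M)` follows its chirp: there `K x + i y =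
    -- l (P - Re M)`, and the value collapses to `l² ((Re M)² / P - Re M)`.
    · have hid : ∀ l : ℝ, |l| ≤ 1 → -1 ≤ (-K * l ^ 2 - l * (-M.im * l : ℝ) * Complex.I
          + (K * l + (-M.im * l : ℝ) * Complex.I) ^ 2 / (starRingEnd ℂ M + K)).re := by
        intro l hl
        have hMc : starRingEnd ℂ M = M.re - M.im * Complex.I := by
          apply Complex.ext <;> simp
        have : (-K * l ^ 2 - l * (-M.im * l : ℝ) * Complex.I
            + (K * l + (-M.im * l : ℝ) * Complex.I) ^ 2 / (starRingEnd ℂ M + K)) =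
            ((l ^ 2 * M.re ^ 2 : ℝ) : ℂ) * (starRingEnd ℂ M + K)⁻¹ - (l ^ 2 * M.re : ℝ) := by
          field_simp
          rw [hMc]
          push_cast
          ring
        rw [this, Complex.sub_re, Complex.re_ofReal_mul, Complex.ofReal_re]
        have h2 : 0 ≤ l ^ 2 * M.re ^ 2 * ((starRingEnd ℂ M + K)⁻¹).re :=
          mul_nonneg (by positivity) (re_inv_pos hP).le
        have h3 : l ^ 2 ≤ 1 := (sq_le_one_iff_abs_le_one l).2 hl
        nlinarith
      -- `l` is chosen so that the larger coordinate of the direction becomes `1`.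
      rcases le_total |M.im| 1 with h2 | h2
      · refine ⟨1, -M.im * 1, Or.inl ⟨rfl, by simpa using h2⟩, hid 1 (by simp)⟩
      · have h3 : M.im ≠ 0 := fun h => by norm_num [h] at h2
        have h4 : |-M.im⁻¹| ≤ 1 := by
          rw [abs_neg, abs_inv]; exact inv_le_one_of_one_le₀ h2
        refine ⟨-M.im⁻¹, -M.im * -M.im⁻¹, Or.inr ⟨h4, ?_⟩, hid _ h4⟩
        field_simp
  obtain ⟨x, y, hxy, hre⟩ := key
  refine ⟨x, y, hxy, fun r t => ?_⟩
  have hd := overlapExp_second_difference (Real.cosh (2 * s)) (Real.sinh (2 * s)) q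
    (starRingEnd ℂ M + K) v₀ v₁ k r x y t
  rw [← hKq] at hd
  simp_rw [h, norm_mul, Complex.norm_exp]
  set E := overlapExp (Real.cosh (2 * s)) (Real.sinh (2 * s)) q (starRingEnd ℂ M + K) v₀ v₁ k
  have hd' := congrArg Complex.re hd
  rw [show (2 * (t : ℂ) ^ 2) = ((2 * t ^ 2 : ℝ) : ℂ) by push_cast; rfl, Complex.re_ofReal_mul,
    Complex.sub_re, Complex.add_re, show (2 * E r).re = 2 * (E r).re by simp] at hd'
  have hle : 2 * (E r).re ≤ 2 * t ^ 2 + ((E (r + t • ![x, y, 0, 0])).re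
      + (E (r - t • ![x, y, 0, 0])).re) := by
    nlinarith [mul_le_mul_of_nonneg_left hre (show 0 ≤ 2 * t ^ 2 by positivity)]
  calc (‖κ‖ * Real.exp (E r).re) ^ 2 = ‖κ‖ ^ 2 * Real.exp (2 * (E r).re) := by
        rw [mul_pow, ← Real.exp_nat_mul]; norm_num
    _ ≤ ‖κ‖ ^ 2 * Real.exp (2 * t ^ 2 + ((E (r + t • ![x, y, 0, 0])).re
      + (E (r - t • ![x, y, 0, 0])).re)) := by gcongr
    _ = _ := by rw [Real.exp_add, Real.exp_add]; ring

/-! ### Spreading of functions with bounded curvature in one direction -/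

theorem measurable_indicator_Icc {α : Type*} [MeasurableSpace α] {f g : α → ℝ} (hf : Measurable f)
    (hg : Measurable g) :
    Measurable fun p : ℝ × α => (Set.Icc (f p.2) (g p.2)).indicator (1 : ℝ → ℝ≥0∞) p.1 := by
  have h : Measurable (({p : ℝ × α | f p.2 ≤ p.1} ∩ {p | p.1 ≤ g p.2}).indicator
      fun _ => (1 : ℝ≥0∞)) := measurable_const.indicator
    ((measurableSet_le (hf.comp measurable_snd) measurable_fst).inter
      (measurableSet_le measurable_fst (hg.comp measurable_snd)))
  convert h with p
  by_cases hp : p.1 ∈ Set.Icc (f p.2) (g p.2)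
  · rw [Set.indicator_of_mem hp, Set.indicator_of_mem (by exact hp)]
    rfl
  · rw [Set.indicator_of_notMem hp, Set.indicator_of_notMem (by exact hp)]

/-- The inequality `hmid` is integrated over `r ∈ A` and over the admissible `t`, of measure at
least `η` by `hAN`; each term on the right is then translated along `e`, and `l` limits how often a
point is hit. -/
theorem lintegral_le_of_midpoint {G : (Fin 4 → ℝ) → ℝ≥0∞} (hG : Measurable G)
    {A N B : Set (Fin 4 → ℝ)} (hA : MeasurableSet A) (hN : MeasurableSet N) (hB : MeasurableSet B)
    {e : Fin 4 → ℝ} {l : (Fin 4 → ℝ) → ℝ} (hl : Measurable l)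
    (hle : ∀ r (t : ℝ), l (r + t • e) = l r + t) {η : ℝ} {a b : ℝ≥0∞}
    (hAl : ∀ r ∈ A, |l r| ≤ 1)
    (hAB : ∀ r ∈ A, ∀ t : ℝ, |l r + t| ≤ η → r - t • e ∈ B)
    (hAN : ∀ r ∈ A, ENNReal.ofReal η ≤ volume {t : ℝ | |l r + t| ≤ η ∧ r + t • e ∈ N})
    (hmid : ∀ r ∈ A, ∀ t : ℝ, |l r + t| ≤ η → G r ≤ a * G (r + t • e) + b * G (r - t • e)) :
    ENNReal.ofReal η * ∫⁻ r in A, G r ≤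
      a * (2 * ∫⁻ r in N, G r) + b * (ENNReal.ofReal η * ∫⁻ r in B, G r) := by
  have hadd : Measurable fun p : (Fin 4 → ℝ) × ℝ => p.1 + p.2 • e := by fun_prop
  have hsub : Measurable fun p : (Fin 4 → ℝ) × ℝ => p.1 - p.2 • e := by fun_prop
  have hlp : Measurable fun p : (Fin 4 → ℝ) × ℝ => |l p.1 + p.2| := by fun_prop
  let φ : (Fin 4 → ℝ) → ℝ → ℝ≥0∞ := fun r t =>
    {p : (Fin 4 → ℝ) × ℝ | p.1 ∈ A ∧ p.1 + p.2 • e ∈ N}.indicator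
      (fun p => G (p.1 + p.2 • e)) (r, t)
  let χ : (Fin 4 → ℝ) → ℝ → ℝ≥0∞ := fun r t =>
    {p : (Fin 4 → ℝ) × ℝ | p.1 ∈ A ∧ |l p.1 + p.2| ≤ η}.indicator
      (fun p => G (p.1 - p.2 • e)) (r, t)
  have hφ : Measurable (Function.uncurry φ) :=
    (hG.comp hadd).indicator ((measurable_fst hA).inter (hadd hN))
  have hχ : Measurable (Function.uncurry χ) :=
    (hG.comp hsub).indicator ((measurable_fst hA).inter (hlp measurableSet_Iic))
  have step : ENNReal.ofReal η * ∫⁻ r in A, G r ≤ ∫⁻ r, ∫⁻ t, (a * φ r t + b * χ r t) := by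
    rw [← lintegral_const_mul _ hG, ← lintegral_indicator hA]
    refine lintegral_mono fun r => ?_
    by_cases hr : r ∈ A
    swap
    · simp [hr]
    rw [Set.indicator_of_mem hr]
    have hD : MeasurableSet {t : ℝ | |l r + t| ≤ η ∧ r + t • e ∈ N} :=
      (measurable_prodMk_left (hlp measurableSet_Iic)).inter (measurable_prodMk_left (hadd hN))
    calc ENNReal.ofReal η * G r
        ≤ G r * volume {t : ℝ | |l r + t| ≤ η ∧ r + t • e ∈ N} := by
          rw [mul_comm]; exact mul_le_mul_right (hAN r hr) _
      _ = ∫⁻ t, {t : ℝ | |l r + t| ≤ η ∧ r + t • e ∈ N}.indicator (fun _ => G r) t := by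
          rw [lintegral_indicator_const hD]
      _ ≤ ∫⁻ t, (a * φ r t + b * χ r t) := by
          refine lintegral_mono fun t => ?_
          by_cases ht : |l r + t| ≤ η ∧ r + t • e ∈ N
          · have h1 : φ r t = G (r + t • e) := Set.indicator_of_mem
              (s := {p : (Fin 4 → ℝ) × ℝ | p.1 ∈ A ∧ p.1 + p.2 • e ∈ N}) ⟨hr, ht.2⟩ _
            have h2 : χ r t = G (r - t • e) := Set.indicator_of_mem
              (s := {p : (Fin 4 → ℝ) × ℝ | p.1 ∈ A ∧ |l p.1 + p.2| ≤ η}) ⟨hr, ht.1⟩ _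
            rw [h1, h2, Set.indicator_of_mem (s := {t : ℝ | |l r + t| ≤ η ∧ r + t • e ∈ N}) ht]
            exact hmid r hr t ht.1
          · rw [Set.indicator_of_notMem (s := {t : ℝ | |l r + t| ≤ η ∧ r + t • e ∈ N}) ht]
            exact zero_le
  -- A point `r' = r + te` comes from `|l r| = |l r' - t| ≤ 1`, an interval of length `2` in `t`.
  have hφle : ∫⁻ r, ∫⁻ t, φ r t ≤ 2 * ∫⁻ r in N, G r := by
    rw [lintegral_lintegral_swap hφ.aemeasurable]
    calc ∫⁻ t, ∫⁻ r, φ r t = ∫⁻ t, ∫⁻ r, φ (r - t • e) t :=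
          lintegral_congr fun t => (lintegral_sub_right_eq_self (fun r => φ r t) (t • e)).symm
      _ ≤ ∫⁻ t, ∫⁻ r, N.indicator G r * (Set.Icc (l r - 1) (l r + 1)).indicator 1 t := by
          refine lintegral_mono fun t => lintegral_mono fun r => ?_
          by_cases h : r - t • e ∈ A ∧ (r - t • e) + t • e ∈ N
          · have h1 : φ (r - t • e) t = G r :=
              (Set.indicator_of_mem (a := (r - t • e, t)) h _).trans (by simp)
            have h2 := hle (r - t • e) t
            rw [sub_add_cancel] at h h2
            have h3 := abs_le.1 (hAl _ h.1)
            rw [h1, Set.indicator_of_mem h.2, Set.indicator_of_mem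
              (show t ∈ Set.Icc (l r - 1) (l r + 1) from ⟨by linarith, by linarith⟩)]
            simp
          · have h1 : φ (r - t • e) t = 0 :=
              Set.indicator_of_notMem (a := (r - t • e, t)) h _
            rw [h1]
            exact zero_le
      _ = ∫⁻ r, ∫⁻ t, N.indicator G r * (Set.Icc (l r - 1) (l r + 1)).indicator 1 t := by
          refine lintegral_lintegral_swap (Measurable.aemeasurable ?_)
          refine ((hG.indicator hN).comp measurable_snd).mul ?_
          exact measurable_indicator_Icc (f := fun r => l r - 1) (g := fun r => l r + 1)
            (by fun_prop) (by fun_prop)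
      _ = 2 * ∫⁻ r in N, G r := by
          rw [← lintegral_indicator hN, ← lintegral_const_mul _ (hG.indicator hN)]
          refine lintegral_congr fun r => ?_
          rw [lintegral_const_mul _ (measurable_one.indicator measurableSet_Icc),
            lintegral_indicator_one measurableSet_Icc, Real.volume_Icc, mul_comm]
          congr 1
          rw [show l r + 1 - (l r - 1) = 2 by ring]
          simp
  -- For `r' = r - te` the condition reads `|l r' + 2t| ≤ η`, an interval of length `η`. This factor
  -- cancels the one on the left, so the term can be made small by `b` alone.
  have hχle : ∫⁻ r, ∫⁻ t, χ r t ≤ ENNReal.ofReal η * ∫⁻ r in B, G r := by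
    rw [lintegral_lintegral_swap hχ.aemeasurable]
    calc ∫⁻ t, ∫⁻ r, χ r t = ∫⁻ t, ∫⁻ r, χ (r + t • e) t :=
          lintegral_congr fun t => (lintegral_add_right_eq_self (fun r => χ r t) (t • e)).symm
      _ ≤ ∫⁻ t, ∫⁻ r, B.indicator G r *
          (Set.Icc ((-η - l r) / 2) ((η - l r) / 2)).indicator 1 t := by
          refine lintegral_mono fun t => lintegral_mono fun r => ?_
          by_cases h : r + t • e ∈ A ∧ |l (r + t • e) + t| ≤ η
          · have h1 : χ (r + t • e) t = G r :=
              (Set.indicator_of_mem (a := (r + t • e, t)) h _).trans (by simp)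
            have h2 := hAB _ h.1 t h.2
            rw [add_sub_cancel_right] at h2
            have h3 := abs_le.1 h.2
            rw [hle] at h3
            rw [h1, Set.indicator_of_mem h2, Set.indicator_of_mem
              (show t ∈ Set.Icc ((-η - l r) / 2) ((η - l r) / 2) from
                ⟨by linarith, by linarith⟩)]
            simp
          · have h1 : χ (r + t • e) t = 0 :=
              Set.indicator_of_notMem (a := (r + t • e, t)) h _
            rw [h1]
            exact zero_le
      _ = ∫⁻ r, ∫⁻ t, B.indicator G r *
          (Set.Icc ((-η - l r) / 2) ((η - l r) / 2)).indicator 1 t := by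
          refine lintegral_lintegral_swap (Measurable.aemeasurable ?_)
          refine ((hG.indicator hB).comp measurable_snd).mul ?_
          exact measurable_indicator_Icc (f := fun r => (-η - l r) / 2) (g := fun r => (η - l r) / 2)
            (by fun_prop) (by fun_prop)
      _ = ENNReal.ofReal η * ∫⁻ r in B, G r := by
          rw [← lintegral_indicator hB, ← lintegral_const_mul _ (hG.indicator hB)]
          refine lintegral_congr fun r => ?_
          rw [lintegral_const_mul _ (measurable_one.indicator measurableSet_Icc),
            lintegral_indicator_one measurableSet_Icc, Real.volume_Icc, mul_comm]
          congr 2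
          ring
  refine step.trans ?_
  have hφr : Measurable fun r => ∫⁻ t, φ r t := hφ.lintegral_prod_right'
  have hχr : Measurable fun r => ∫⁻ t, χ r t := hχ.lintegral_prod_right'
  have hsplit : ∀ r, ∫⁻ t, (a * φ r t + b * χ r t) =
      (a * ∫⁻ t, φ r t) + b * ∫⁻ t, χ r t := by
    intro r
    have h1 : Measurable fun t => φ r t := hφ.comp measurable_prodMk_left
    have h2 : Measurable fun t => χ r t := hχ.comp measurable_prodMk_left
    rw [lintegral_add_left (h1.const_mul a), lintegral_const_mul _ h1, lintegral_const_mul _ h2]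
  simp_rw [hsplit]
  rw [lintegral_add_left (hφr.const_mul a), lintegral_const_mul _ hφr, lintegral_const_mul _ hχr]
  exact add_le_add (mul_le_mul_right hφle a) (mul_le_mul_right hχle b)

/-! ### Boxes -/

/-- The set `|a - c| ≤ ρ`, `|b + d| ≤ ρ`, `|c| ≤ 1`, `|d| ≤ 1`. -/
def box (ρ : ℝ) : Set (Fin 4 → ℝ) :=
  {r | |r 0 - r 2| ≤ ρ ∧ |r 1 + r 3| ≤ ρ ∧ |r 2| ≤ 1 ∧ |r 3| ≤ 1}

theorem measurableSet_box (ρ : ℝ) : MeasurableSet (box ρ) := by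
  have h : ∀ (f : (Fin 4 → ℝ) → ℝ) (c : ℝ), Measurable f → MeasurableSet {r | |f r| ≤ c} :=
    fun f c hf => measurableSet_le hf.abs measurable_const
  exact (h (fun r => r 0 - r 2) ρ (by fun_prop)).inter ((h (fun r => r 1 + r 3) ρ
    (by fun_prop)).inter ((h (fun r => r 2) 1 (by fun_prop)).inter (h (fun r => r 3) 1
      (by fun_prop))))

theorem volume_box {ρ : ℝ} (hρ : 0 ≤ ρ) : volume (box ρ) = ENNReal.ofReal (16 * ρ ^ 2) := by
  let M : Matrix (Fin 4) (Fin 4) ℝ := !![1, 0, -1, 0; 0, 1, 0, 1; 0, 0, 1, 0; 0, 0, 0, 1]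
  have hdet : M.det = 1 := by
    simp [M, Matrix.det_succ_row_zero, Fin.sum_univ_succ, Fin.succAbove]
  have hmap := Real.map_matrix_volume_pi_eq_smul_volume_pi (M := M) (by rw [hdet]; norm_num)
  rw [hdet] at hmap
  have hbox : box ρ = Matrix.toLin' M ⁻¹' Set.pi Set.univ
      fun i => Set.Icc (-(![ρ, ρ, 1, 1] i)) (![ρ, ρ, 1, 1] i) := by
    ext r
    have h0 : Matrix.toLin' M r 0 = r 0 - r 2 := by
      simp [M, Matrix.mulVec, dotProduct, Fin.sum_univ_four, sub_eq_add_neg]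
    have h1 : Matrix.toLin' M r 1 = r 1 + r 3 := by
      simp [M, Matrix.mulVec, dotProduct, Fin.sum_univ_four]
    have h2 : Matrix.toLin' M r 2 = r 2 := by
      simp [M, Matrix.mulVec, dotProduct, Fin.sum_univ_four]
    have h3 : Matrix.toLin' M r 3 = r 3 := by
      simp [M, Matrix.mulVec, dotProduct, Fin.sum_univ_four]
    simp only [box, Set.mem_ofPred_eq, Set.mem_preimage, Set.mem_univ_pi, Set.mem_Icc, abs_le]
    refine ⟨fun ⟨a, b, c, d⟩ i => ?_, fun h => ⟨?_, ?_, ?_, ?_⟩⟩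
    · fin_cases i
      · exact h0 ▸ a
      · exact h1 ▸ b
      · exact h2 ▸ c
      · exact h3 ▸ d
    · exact h0 ▸ h 0
    · exact h1 ▸ h 1
    · exact h2 ▸ h 2
    · exact h3 ▸ h 3
  have hm : Measurable (Matrix.toLin' M) :=
    (LinearMap.continuous_of_finiteDimensional _).measurable
  rw [hbox, ← Measure.map_apply hm (MeasurableSet.univ_pi fun i => measurableSet_Icc), hmap]
  simp only [inv_one, abs_one, ENNReal.ofReal_one, one_smul]
  rw [volume_pi, Measure.pi_pi, Fin.prod_univ_four]
  simp only [Real.volume_Icc]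
  rw [← ENNReal.ofReal_mul (by simp; linarith), ← ENNReal.ofReal_mul (by simp; positivity),
    ← ENNReal.ofReal_mul (by simp; positivity)]
  congr 1
  simp
  ring

/-- The displacements for which `alpha` is positive, respectively negative. -/
def signSet : Bool → Set (Fin 4 → ℝ)
  | true => {r | 0 < alpha r}
  | false => {r | alpha r < 0}

theorem measurableSet_signSet (b : Bool) : MeasurableSet (signSet b) := by
  cases b
  · exact measurableSet_lt continuous_alpha.measurable measurable_const
  · exact measurableSet_lt measurable_const continuous_alpha.measurable

/-- While `|l + t| ≤ η`, the other factor stays within `η` of its value `m - y l` at the crossing.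
If that value exceeds `η` in modulus its sign is fixed, and one side of the crossing gives the
desired product; otherwise the factor is at most `2η` throughout. -/
theorem exists_interval_sign {l m y η : ℝ} (hy : |y| ≤ 1) :
    (∃ t₀, ∀ t ∈ Set.Ioo t₀ (t₀ + η), |l + t| ≤ η ∧
      (0 < (l + t) * (m + y * t) ∨ |m + y * t| ≤ 2 * η)) ∧
    ∃ t₀, ∀ t ∈ Set.Ioo t₀ (t₀ + η), |l + t| ≤ η ∧
      ((l + t) * (m + y * t) < 0 ∨ |m + y * t| ≤ 2 * η) := by
  have hpos : ∀ t ∈ Set.Ioo (-l) (-l + η), 0 < l + t ∧ |l + t| ≤ η := fun t ht => by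
    have h1 := ht.1
    have h2 := ht.2
    exact ⟨by linarith, abs_le.2 ⟨by linarith, by linarith⟩⟩
  have hneg : ∀ t ∈ Set.Ioo (-l - η) (-l - η + η), l + t < 0 ∧ |l + t| ≤ η := fun t ht => by
    have h1 := ht.1
    have h2 := ht.2
    exact ⟨by linarith, abs_le.2 ⟨by linarith, by linarith⟩⟩
  have hm : ∀ t, |l + t| ≤ η → |(m + y * t) - (m - y * l)| ≤ η := fun t ht => by
    rw [show m + y * t - (m - y * l) = y * (l + t) by ring, abs_mul]
    nlinarith [abs_nonneg y, abs_nonneg (l + t)]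
  rcases lt_or_ge η (m - y * l) with h | h
  · have hs : ∀ t, |l + t| ≤ η → 0 < m + y * t := fun t ht => by
      have := (abs_le.1 (hm t ht)).1
      linarith
    exact ⟨⟨-l, fun t ht => ⟨(hpos t ht).2, Or.inl (mul_pos (hpos t ht).1 (hs t (hpos t ht).2))⟩⟩,
      ⟨-l - η, fun t ht => ⟨(hneg t ht).2,
        Or.inl (mul_neg_of_neg_of_pos (hneg t ht).1 (hs t (hneg t ht).2))⟩⟩⟩
  rcases lt_or_ge (m - y * l) (-η) with h' | h'
  · have hs : ∀ t, |l + t| ≤ η → m + y * t < 0 := fun t ht => by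
      have := (abs_le.1 (hm t ht)).2
      linarith
    exact ⟨⟨-l - η, fun t ht => ⟨(hneg t ht).2,
        Or.inl (mul_pos_of_neg_of_neg (hneg t ht).1 (hs t (hneg t ht).2))⟩⟩,
      ⟨-l, fun t ht => ⟨(hpos t ht).2,
        Or.inl (mul_neg_of_pos_of_neg (hpos t ht).1 (hs t (hpos t ht).2))⟩⟩⟩
  · have hs : ∀ t, |l + t| ≤ η → |m + y * t| ≤ 2 * η := fun t ht => by
      have := abs_le.1 (hm t ht)
      exact abs_le.2 ⟨by linarith, by linarith⟩
    exact ⟨⟨-l, fun t ht => ⟨(hpos t ht).2, Or.inr (hs t (hpos t ht).2)⟩⟩,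
      ⟨-l, fun t ht => ⟨(hpos t ht).2, Or.inr (hs t (hpos t ht).2)⟩⟩⟩

/-- Here `l` is whichever of `a - c`, `b + d` moves at unit speed and `m` is the other, which covers
both kinds of direction. Starting in `box 1` one has `|t| ≤ 2`, so both reflected points lie well
inside `box 6`. -/
theorem lintegral_box_le {G : (Fin 4 → ℝ) → ℝ≥0∞} (hG : Measurable G) {e : Fin 4 → ℝ}
    {l m : (Fin 4 → ℝ) → ℝ} {y η : ℝ} {a c : ℝ≥0∞} (hη : 0 < η) (hη1 : η ≤ 1) (hy : |y| ≤ 1)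
    (hl : Measurable l) (hle : ∀ r (t : ℝ), l (r + t • e) = l r + t)
    (hme : ∀ r (t : ℝ), m (r + t • e) = m r + y * t) (hα : ∀ r, alpha r = l r * m r)
    (hbox : ∀ ρ r, r ∈ box ρ ↔ |l r| ≤ ρ ∧ |m r| ≤ ρ ∧ |r 2| ≤ 1 ∧ |r 3| ≤ 1)
    (he2 : e 2 = 0) (he3 : e 3 = 0)
    (hmid : ∀ r (t : ℝ), |t| ≤ 2 → G r ≤ a * G (r + t • e) + c * G (r - t • e)) (b : Bool) :
    ENNReal.ofReal η * ∫⁻ r in box 1, G r ≤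
      a * (2 * ∫⁻ r in signSet b ∩ box 6 ∪ box (2 * η), G r) +
        c * (ENNReal.ofReal η * ∫⁻ r in box 6, G r) := by
  have ht2 : ∀ r ∈ box 1, ∀ t : ℝ, |l r + t| ≤ η → |t| ≤ 2 := fun r hr t ht => by
    have h1 := abs_le.1 ((hbox 1 r).1 hr).1
    have h2 := abs_le.1 ht
    exact abs_le.2 ⟨by linarith, by linarith⟩
  have hyt : ∀ t : ℝ, |t| ≤ 2 → |y * t| ≤ 2 := fun t ht => by
    rw [abs_mul]; nlinarith [abs_nonneg y, abs_nonneg t]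
  have h6 : ∀ r ∈ box 1, ∀ t : ℝ, |t| ≤ 2 → r + t • e ∈ box 6 := fun r hr t ht => by
    obtain ⟨h1, h2, h3, h4⟩ := (hbox 1 r).1 hr
    refine (hbox 6 _).2 ⟨?_, ?_, by simpa [he2] using h3, by simpa [he3] using h4⟩
    · rw [hle]
      exact (abs_add_le _ _).trans (by linarith)
    · rw [hme]
      exact (abs_add_le _ _).trans (by linarith [hyt t ht])
  refine lintegral_le_of_midpoint hG (measurableSet_box 1)
    (((measurableSet_signSet b).inter (measurableSet_box 6)).union (measurableSet_box _))
    (measurableSet_box 6) hl hle (fun r hr => ((hbox 1 r).1 hr).1) (fun r hr t ht => ?_)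
    (fun r hr => ?_) fun r hr t ht => hmid r t (ht2 r hr t ht)
  · have := h6 r hr (-t) (by rw [abs_neg]; exact ht2 r hr t ht)
    rwa [neg_smul, ← sub_eq_add_neg] at this
  · have key : ∃ t₀, ∀ t ∈ Set.Ioo t₀ (t₀ + η), |l r + t| ≤ η ∧
        (r + t • e ∈ signSet b ∨ |m r + y * t| ≤ 2 * η) := by
      obtain ⟨hp, hn⟩ := exists_interval_sign (l := l r) (m := m r) (η := η) hy
      cases b
      · obtain ⟨t₀, h⟩ := hn
        refine ⟨t₀, fun t ht => ⟨(h t ht).1, (h t ht).2.imp_left fun h' => ?_⟩⟩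
        rwa [← hle, ← hme, ← hα] at h'
      · obtain ⟨t₀, h⟩ := hp
        refine ⟨t₀, fun t ht => ⟨(h t ht).1, (h t ht).2.imp_left fun h' => ?_⟩⟩
        rwa [← hle, ← hme, ← hα] at h'
    obtain ⟨t₀, h⟩ := key
    have hvol : volume (Set.Ioo t₀ (t₀ + η)) = ENNReal.ofReal η := by
      rw [Real.volume_Ioo]; congr 1; ring
    rw [← hvol]
    refine measure_mono fun t ht => ⟨(h t ht).1, ?_⟩
    have hb := h6 r hr t (ht2 r hr t (h t ht).1)
    rcases (h t ht).2 with h' | h'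
    · exact Or.inl ⟨h', hb⟩
    · obtain ⟨-, -, h3, h4⟩ := (hbox 6 _).1 hb
      refine Or.inr ((hbox _ _).2 ⟨?_, by rwa [hme], h3, h4⟩)
      rw [hle]
      linarith [(h t ht).1]

/-- A product Gaussian vector which overlaps with the states in the unit box also overlaps with
states of either sign, or with states near the origin. -/
theorem lintegral_box_overlap_le (s : ℝ) {f g : Modes 1} (hf : IsGaussianVec f)
    (hg : IsGaussianVec g) {η κ : ℝ} (hη : 0 < η) (hη1 : η ≤ 1) (hκ : 0 < κ) (b : Bool) :
    ENNReal.ofReal η * ∫⁻ r in box 1, ‖inner ℂ (prodVec f g) (state s r)‖ₑ ^ 2 ≤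
      ENNReal.ofReal (Real.exp 8 * κ) * (2 * ∫⁻ r in signSet b ∩ box 6 ∪ box (2 * η),
        ‖inner ℂ (prodVec f g) (state s r)‖ₑ ^ 2) +
      ENNReal.ofReal (Real.exp 8 / κ) * (ENNReal.ofReal η * ∫⁻ r in box 6,
        ‖inner ℂ (prodVec f g) (state s r)‖ₑ ^ 2) := by
  have hG : Measurable fun r => ‖inner ℂ (prodVec f g) (state s r)‖ₑ ^ 2 :=
    ((continuous_const.inner (continuous_state s)).enorm.measurable).pow_const 2
  obtain ⟨x, y, hxy, h⟩ := exists_direction s hf hg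
  have hmid : ∀ r (t : ℝ), |t| ≤ 2 → ‖inner ℂ (prodVec f g) (state s r)‖ₑ ^ 2 ≤
      ENNReal.ofReal (Real.exp 8 * κ) *
        ‖inner ℂ (prodVec f g) (state s (r + t • ![x, y, 0, 0]))‖ₑ ^ 2 +
      ENNReal.ofReal (Real.exp 8 / κ) *
        ‖inner ℂ (prodVec f g) (state s (r - t • ![x, y, 0, 0]))‖ₑ ^ 2 := by
    intro r t ht
    simp_rw [enorm_sq_eq_ofReal]
    rw [← ENNReal.ofReal_mul (by positivity), ← ENNReal.ofReal_mul (by positivity),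
      ← ENNReal.ofReal_add (by positivity) (by positivity)]
    refine ENNReal.ofReal_le_ofReal ((h r t).trans ?_)
    have he : Real.exp (2 * t ^ 2) ≤ Real.exp 8 := by
      have := sq_le_sq' (abs_le.1 ht).1 (abs_le.1 ht).2
      exact Real.exp_le_exp.2 (by linarith)
    have hp := norm_nonneg (inner ℂ (prodVec f g) (state s (r + t • ![x, y, 0, 0])))
    have hq := norm_nonneg (inner ℂ (prodVec f g) (state s (r - t • ![x, y, 0, 0])))
    generalize ‖inner ℂ (prodVec f g) (state s (r + t • ![x, y, 0, 0]))‖ = p at *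
    generalize ‖inner ℂ (prodVec f g) (state s (r - t • ![x, y, 0, 0]))‖ = q at *
    -- Weighted arithmetic-geometric mean: a large `κ` makes the uncontrolled point `r - te` cheap.
    have hpq : p * q ≤ κ * p ^ 2 + q ^ 2 / κ := by
      rw [← sub_nonneg, show κ * p ^ 2 + q ^ 2 / κ - p * q =
        ((κ * p - q) ^ 2 + κ * (p * q)) / κ by field_simp; ring]
      positivity
    calc Real.exp (2 * t ^ 2) * (p * q) ≤ Real.exp 8 * (κ * p ^ 2 + q ^ 2 / κ) :=
          mul_le_mul he hpq (by positivity) (by positivity)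
      _ = _ := by ring
  rcases hxy with ⟨rfl, hy⟩ | ⟨hx, rfl⟩
  · exact lintegral_box_le hG (l := fun r => r 0 - r 2) (m := fun r => r 1 + r 3) hη hη1 hy
      (by fun_prop) (fun r t => by simp; ring) (fun r t => by simp; ring) (fun r => rfl)
      (fun ρ r => Iff.rfl) (by simp) (by simp) hmid b
  · exact lintegral_box_le hG (l := fun r => r 1 + r 3) (m := fun r => r 0 - r 2) hη hη1 hx
      (by fun_prop) (fun r t => by simp; ring) (fun r t => by simp; ring) (fun r => mul_comm _ _)
      (fun ρ r => ⟨fun ⟨h1, h2, h3⟩ => ⟨h2, h1, h3⟩, fun ⟨h1, h2, h3⟩ => ⟨h2, h1, h3⟩⟩)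
      (by simp) (by simp) hmid b

/-! ### The bound on the success probability of GLOCC measurements -/

/-- A lower bound of the prior on `box 6`. -/
def priorMin (σ : ℝ) : ℝ := 1 / (4 * Real.pi ^ 2 * σ ^ 4) * Real.exp (-100 / (2 * σ ^ 2))

theorem priorMin_pos {σ : ℝ} (hσ : 0 < σ) : 0 < priorMin σ := by
  unfold priorMin; positivity

theorem priorMin_le {σ : ℝ} (hσ : 0 < σ) {r : Fin 4 → ℝ} (hr : r ∈ box 6) :
    priorMin σ ≤ prior σ r := by
  obtain ⟨h0, h1, h2, h3⟩ := hr
  rw [abs_le] at h0 h1 h2 h3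
  unfold priorMin prior
  gcongr
  -- On `box 6`, `|a|, |b| ≤ 6 + 1`, and `7² + 7² + 1 + 1 = 100`.
  rw [Fin.sum_univ_four]
  have e0 : r 0 ^ 2 ≤ 7 ^ 2 := sq_le_sq' (by linarith) (by linarith)
  have e1 : r 1 ^ 2 ≤ 7 ^ 2 := sq_le_sq' (by linarith) (by linarith)
  have e2 : r 2 ^ 2 ≤ 1 ^ 2 := sq_le_sq' (by linarith) (by linarith)
  have e3 : r 3 ^ 2 ≤ 1 ^ 2 := sq_le_sq' (by linarith) (by linarith)
  linarith

/-- The prior, with weight moved away from the unit box. -/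
def weight (σ η κ : ℝ) (r : Fin 4 → ℝ) : ℝ :=
  prior σ r + (box (2 * η)).indicator (fun _ => priorMin σ) r
    + (box 6).indicator (fun _ => priorMin σ * η / (2 * κ ^ 2)) r
    - (box 1).indicator (fun _ => priorMin σ * η / (2 * Real.exp 8 * κ)) r

theorem measurable_weight (σ η κ : ℝ) : Measurable (weight σ η κ) :=
  (((continuous_prior σ).measurable.add (measurable_const.indicator (measurableSet_box _))).add
    (measurable_const.indicator (measurableSet_box _))).sub
    (measurable_const.indicator (measurableSet_box _))

theorem box_mono {ρ ρ' : ℝ} (h : ρ ≤ ρ') : box ρ ⊆ box ρ' :=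
  fun _ hr => ⟨hr.1.trans h, hr.2.1.trans h, hr.2.2⟩

theorem indicator_mul_lintegral {A : Set (Fin 4 → ℝ)} (hA : MeasurableSet A) (c : ℝ)
    {G : (Fin 4 → ℝ) → ℝ≥0∞} (hG : Measurable G) :
    ∫⁻ r, ENNReal.ofReal (A.indicator (fun _ => c) r) * G r =
      ENNReal.ofReal c * ∫⁻ r in A, G r := by
  rw [← lintegral_const_mul _ hG, ← lintegral_indicator hA]
  refine lintegral_congr fun r => ?_
  by_cases hr : r ∈ A <;> simp [hr]

/-- The negative part of `weight` is put on the left to avoid truncated subtraction; `hηκ` keeps it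
below the prior, so `weight` is nonnegative. -/
theorem lintegral_weight_mul {σ η κ : ℝ} (hσ : 0 < σ) (hη : 0 < η) (hκ : 0 < κ)
    (hηκ : η ≤ 2 * Real.exp 8 * κ) {G : (Fin 4 → ℝ) → ℝ≥0∞} (hG : Measurable G) :
    (∫⁻ r, ENNReal.ofReal (weight σ η κ r) * G r) +
      ENNReal.ofReal (priorMin σ * η / (2 * Real.exp 8 * κ)) * ∫⁻ r in box 1, G r =
    (∫⁻ r, ENNReal.ofReal (prior σ r) * G r) + ENNReal.ofReal (priorMin σ) *
      (∫⁻ r in box (2 * η), G r) +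
      ENNReal.ofReal (priorMin σ * η / (2 * κ ^ 2)) * ∫⁻ r in box 6, G r := by
  have hp := priorMin_pos hσ
  have hind : ∀ (A : Set (Fin 4 → ℝ)) {c : ℝ}, 0 ≤ c → ∀ r, 0 ≤ A.indicator (fun _ => c) r :=
    fun A c hc r => Set.indicator_nonneg (fun _ _ => hc) r
  have hδ : priorMin σ * η / (2 * Real.exp 8 * κ) ≤ priorMin σ := by
    rw [mul_div_assoc]
    exact mul_le_of_le_one_right hp.le ((div_le_one (by positivity)).2 hηκ)
  have hw : ∀ r, 0 ≤ weight σ η κ r := by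
    intro r
    have h1 := hind (box (2 * η)) hp.le r
    have h2 := hind (box 6) (c := priorMin σ * η / (2 * κ ^ 2)) (by positivity) r
    have h3 : (box 1).indicator (fun _ => priorMin σ * η / (2 * Real.exp 8 * κ)) r ≤ prior σ r := by
      by_cases hr : r ∈ box 1
      · rw [Set.indicator_of_mem hr]
        exact hδ.trans (priorMin_le hσ (box_mono (by norm_num) hr))
      · rw [Set.indicator_of_notMem hr]
        exact (prior_pos hσ r).le
    unfold weight
    linarith
  have hm : ∀ (ρ c : ℝ), Measurable fun r =>
      ENNReal.ofReal ((box ρ).indicator (fun _ => c) r) * G r :=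
    fun ρ c => (measurable_const.indicator (measurableSet_box ρ)).ennreal_ofReal.mul hG
  rw [← indicator_mul_lintegral (measurableSet_box 1) _ hG,
    ← indicator_mul_lintegral (measurableSet_box _) _ hG,
    ← indicator_mul_lintegral (measurableSet_box _) _ hG,
    ← lintegral_add_right _ (hm _ _), ← lintegral_add_right _ (hm _ _),
    ← lintegral_add_right _ (hm _ _)]
  refine lintegral_congr fun r => ?_
  have h1 := hind (box (2 * η)) hp.le r
  have h2 := hind (box 6) (c := priorMin σ * η / (2 * κ ^ 2)) (by positivity) r
  have h3 := hind (box 1) (c := priorMin σ * η / (2 * Real.exp 8 * κ)) (by positivity) r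
  rw [← add_mul, ← add_mul, ← add_mul, ← ENNReal.ofReal_add (hw r) h3,
    ← ENNReal.ofReal_add (prior_pos hσ r).le h1,
    ← ENNReal.ofReal_add (add_nonneg (prior_pos hσ r).le h1) h2]
  congr 2
  unfold weight
  ring

theorem lintegral_weight {σ η κ : ℝ} (hσ : 0 < σ) (hη : 0 < η) (hκ : 0 < κ)
    (hηκ : η ≤ 2 * Real.exp 8 * κ) :
    ∫⁻ r, ENNReal.ofReal (weight σ η κ r) = ENNReal.ofReal (1 + priorMin σ * (64 * η ^ 2)
      + priorMin σ * η / (2 * κ ^ 2) * 576 - priorMin σ * η / (2 * Real.exp 8 * κ) * 16) := by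
  have hp := priorMin_pos hσ
  have h := lintegral_weight_mul hσ hη hκ hηκ (G := fun _ => 1) measurable_const
  simp only [mul_one, setLIntegral_const, one_mul] at h
  rw [← ofReal_integral_eq_lintegral_ofReal (integrable_prior hσ)
    (Eventually.of_forall fun r => (prior_pos hσ r).le), integral_prior hσ,
    volume_box (ρ := 2 * η) (by positivity), volume_box (ρ := 6) (by norm_num),
    volume_box (ρ := 1) (by norm_num),
    ← ENNReal.ofReal_mul (by positivity), ← ENNReal.ofReal_mul (by positivity),
    ← ENNReal.ofReal_mul (by positivity), ← ENNReal.ofReal_add (by norm_num) (by positivity),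
    ← ENNReal.ofReal_add (by positivity) (by positivity)] at h
  rw [ENNReal.eq_sub_of_add_eq ENNReal.ofReal_ne_top h, ← ENNReal.ofReal_sub _ (by positivity)]
  congr 1
  ring

/-- The operators `ρ₊` and `ρ₋`. -/
def rhoSign (σ s : ℝ) (b : Bool) : Op := (2 : ℝ) • ∫ r in signSet b, prior σ r • rho s r

theorem inner_rhoSign {σ : ℝ} (hσ : 0 < σ) (s : ℝ) (b : Bool) (h : Modes 2) :
    inner ℂ h (rhoSign σ s b h) =
      ((2 * ∫ r in signSet b, prior σ r * ‖inner ℂ h (state s r)‖ ^ 2 : ℝ) : ℂ) := by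
  rw [rhoSign, _root_.smul_apply, inner_smul_right_eq_smul, inner_setIntegral_rho hσ,
    Complex.real_smul, ← Complex.ofReal_mul]

theorem isPositive_rhoSign {σ : ℝ} (hσ : 0 < σ) (s : ℝ) (b : Bool) : (rhoSign σ s b).IsPositive := by
  rw [ContinuousLinearMap.isPositive_iff_complex]
  intro h
  have h' := inner_rhoSign hσ s b h
  rw [← inner_conj_symm, h', Complex.conj_ofReal]
  refine ⟨by simp, ?_⟩
  rw [RCLike.re_to_complex, Complex.ofReal_re]
  exact mul_nonneg zero_le_two (integral_nonneg fun r =>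
    mul_nonneg (prior_pos hσ r).le (sq_nonneg _))

theorem ofReal_inner_rhoSign {σ : ℝ} (hσ : 0 < σ) (s : ℝ) (b : Bool) (h : Modes 2) :
    ENNReal.ofReal (inner ℂ h (rhoSign σ s b h)).re =
      2 * ∫⁻ r in signSet b, ENNReal.ofReal (prior σ r) * ‖inner ℂ h (state s r)‖ₑ ^ 2 := by
  have hc : Continuous fun r => ‖inner ℂ h (state s r)‖ ^ 2 :=
    ((continuous_const.inner (continuous_state s)).norm).pow 2
  have hI : Integrable fun r => prior σ r * ‖inner ℂ h (state s r)‖ ^ 2 := by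
    refine (integrable_prior hσ).mul_bdd (c := ‖h‖ ^ 2) hc.aestronglyMeasurable
      (Eventually.of_forall fun r => ?_)
    rw [norm_pow, norm_norm]
    refine pow_le_pow_left₀ (norm_nonneg _) ?_ 2
    simpa [norm_state] using norm_inner_le_norm (𝕜 := ℂ) h (state s r)
  rw [inner_rhoSign hσ, Complex.ofReal_re, ENNReal.ofReal_mul zero_le_two, ENNReal.ofReal_ofNat,
    ofReal_integral_eq_lintegral_ofReal hI.integrableOn
      (Eventually.of_forall fun r => mul_nonneg (prior_pos hσ r).le (sq_nonneg _))]
  simp_rw [ENNReal.ofReal_mul (prior_pos hσ _).le, enorm_sq_eq_ofReal]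

theorem ofReal_inner_rhoSign_le {σ η κ : ℝ} (hσ : 0 < σ) (hη : 0 < η) (hη1 : η ≤ 1) (hκ : 0 < κ)
    (hηκ : η ≤ 2 * Real.exp 8 * κ) (s : ℝ) {f g : Modes 1} (hf : IsGaussianVec f)
    (hg : IsGaussianVec g) (b : Bool) :
    ENNReal.ofReal (inner ℂ (prodVec f g) (rhoSign σ s b (prodVec f g))).re ≤
      ∫⁻ r, 2 * ENNReal.ofReal (weight σ η κ r) * ‖inner ℂ (prodVec f g) (state s r)‖ₑ ^ 2 := by
  have hp := priorMin_pos hσ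
  set G : (Fin 4 → ℝ) → ℝ≥0∞ := fun r => ‖inner ℂ (prodVec f g) (state s r)‖ₑ ^ 2
  have hG : Measurable G :=
    ((continuous_const.inner (continuous_state s)).enorm.measurable).pow_const 2
  have hwm : Measurable fun r => ENNReal.ofReal (weight σ η κ r) :=
    (measurable_weight σ η κ).ennreal_ofReal
  have hPm : Measurable fun r => ENNReal.ofReal (prior σ r) :=
    (continuous_prior σ).measurable.ennreal_ofReal
  simp_rw [mul_assoc]
  have hwG : Measurable fun r => ENNReal.ofReal (weight σ η κ r) * G r := hwm.mul hG
  rw [ofReal_inner_rhoSign hσ, lintegral_const_mul _ hwG]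
  refine mul_le_mul_right ?_ 2
  change ∫⁻ r in signSet b, ENNReal.ofReal (prior σ r) * G r ≤
    ∫⁻ r, ENNReal.ofReal (weight σ η κ r) * G r
  -- Finiteness permits cancelling this term at the end.
  have hfin : ENNReal.ofReal (priorMin σ * η / (2 * Real.exp 8 * κ)) * ∫⁻ r in box 1, G r ≠ ∞ := by
    refine ENNReal.mul_ne_top ENNReal.ofReal_ne_top (ne_of_lt ?_)
    refine setLIntegral_lt_top_of_le_nnreal (by rw [volume_box zero_le_one]; simp)
      ⟨‖prodVec f g‖₊ ^ 2, fun r _ => ?_⟩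
    change ‖inner ℂ (prodVec f g) (state s r)‖ₑ ^ 2 ≤ _
    rw [ENNReal.coe_pow, ← enorm_eq_nnnorm, enorm_sq_eq_ofReal, enorm_sq_eq_ofReal]
    refine ENNReal.ofReal_le_ofReal (pow_le_pow_left₀ (norm_nonneg _) ?_ 2)
    simpa [norm_state] using norm_inner_le_norm (𝕜 := ℂ) (prodVec f g) (state s r)
  -- The spreading bound is used for the wrong sign `!b`; the multiplier turns the coefficient of
  -- the wrong-sign set into `priorMin σ`, so that the prior dominates it.
  have hspread := mul_le_mul_right (lintegral_box_overlap_le s hf hg hη hη1 hκ (!b))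
    (ENNReal.ofReal (priorMin σ / (2 * Real.exp 8 * κ)))
  have hsum := lintegral_weight_mul hσ hη hκ hηκ hG
  have hN : ∫⁻ r in signSet (!b) ∩ box 6 ∪ box (2 * η), G r ≤
      (∫⁻ r in signSet (!b) ∩ box 6, G r) + ∫⁻ r in box (2 * η), G r :=
    lintegral_union_le _ _ _
  have hwrong : ENNReal.ofReal (priorMin σ) * ∫⁻ r in signSet (!b) ∩ box 6, G r ≤
      ∫⁻ r in signSet (!b), ENNReal.ofReal (prior σ r) * G r := by
    rw [← lintegral_const_mul _ hG]
    refine (setLIntegral_mono (hPm.mul hG) fun r hr => ?_).trans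
      (lintegral_mono_set Set.inter_subset_left)
    exact mul_le_mul_left (ENNReal.ofReal_le_ofReal (priorMin_le hσ hr.2)) _
  have htotal : (∫⁻ r in signSet b, ENNReal.ofReal (prior σ r) * G r) +
      ∫⁻ r in signSet (!b), ENNReal.ofReal (prior σ r) * G r ≤
      ∫⁻ r, ENNReal.ofReal (prior σ r) * G r := by
    rw [← lintegral_union (measurableSet_signSet _)]
    · exact setLIntegral_le_lintegral _ _
    · rw [Set.disjoint_left]
      intro r h1 h2
      cases b
      · exact lt_asymm (show alpha r < 0 from h1) h2
      · exact lt_asymm (show 0 < alpha r from h1) h2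
  have hX : ENNReal.ofReal (priorMin σ * η / (2 * Real.exp 8 * κ)) * ∫⁻ r in box 1, G r ≤
      ENNReal.ofReal (priorMin σ) * (∫⁻ r in signSet (!b) ∩ box 6 ∪ box (2 * η), G r) +
      ENNReal.ofReal (priorMin σ * η / (2 * κ ^ 2)) * ∫⁻ r in box 6, G r := by
    rw [mul_add, ← mul_assoc, ← mul_assoc, ← mul_assoc, ← mul_assoc, ← mul_assoc,
      ← ENNReal.ofReal_ofNat, ← ENNReal.ofReal_mul (by positivity),
      ← ENNReal.ofReal_mul (by positivity), ← ENNReal.ofReal_mul (by positivity),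
      ← ENNReal.ofReal_mul (by positivity), ← ENNReal.ofReal_mul (by positivity)] at hspread
    convert hspread using 3
    · ring
    · congr 1; field_simp
    · congr 1; field_simp
  refine (ENNReal.add_le_add_iff_right hfin).1 ?_
  rw [hsum]
  calc _ ≤ (∫⁻ r in signSet b, ENNReal.ofReal (prior σ r) * G r) +
        (ENNReal.ofReal (priorMin σ) * ((∫⁻ r in signSet (!b) ∩ box 6, G r) +
          ∫⁻ r in box (2 * η), G r) +
        ENNReal.ofReal (priorMin σ * η / (2 * κ ^ 2)) * ∫⁻ r in box 6, G r) := by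
        gcongr
        exact hX.trans (by gcongr)
    _ ≤ (∫⁻ r in signSet b, ENNReal.ofReal (prior σ r) * G r) +
        ((∫⁻ r in signSet (!b), ENNReal.ofReal (prior σ r) * G r) +
          ENNReal.ofReal (priorMin σ) * (∫⁻ r in box (2 * η), G r) +
        ENNReal.ofReal (priorMin σ * η / (2 * κ ^ 2)) * ∫⁻ r in box 6, G r) := by
        rw [mul_add]
        gcongr
    _ ≤ _ := by
        rw [← add_assoc, ← add_assoc]
        gcongr

/-- The success probability of GLOCC measurements is bounded away from `1`. -/
theorem gloccSuccess_le {σ η κ : ℝ} (hσ : 0 < σ) (hη : 0 < η) (hη1 : η ≤ 1) (hκ : 0 < κ)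
    (hηκ : η ≤ 2 * Real.exp 8 * κ) (s : ℝ) {p : Bool → Op → ℝ≥0∞} (hp : IsGLOCCMeasurement p) :
    gloccSuccess σ s p ≤ ∫⁻ r, ENNReal.ofReal (weight σ η κ r) := by
  have hwm : Measurable fun r => ENNReal.ofReal (weight σ η κ r) :=
    (measurable_weight σ η κ).ennreal_ofReal
  have h := IsGLOCC.le_lintegral_branchWeight (continuous_state s) (hwm.const_mul 2)
    (isPositive_rhoSign hσ s) (fun f g hf hg b => ?_) hp adjointGaussian_id adjointGaussian_id
  · change (p true (rhoSign σ s true) + p false (rhoSign σ s false)) / 2 ≤ _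
    refine ENNReal.div_le_of_le_mul' (h.trans ?_)
    rw [← lintegral_const_mul _ hwm]
    refine lintegral_mono fun r => mul_le_of_le_one_right' ((branchWeight_id_le _).trans ?_)
    rw [enorm_sq_eq_ofReal, norm_state]
    simp
  · rcases hf with rfl | hf
    · have : prodVec 0 g = 0 := by simpa using prodVec_smul_left 0 0 g
      simp [this]
    rcases hg with rfl | hg
    · have : prodVec f 0 = 0 := by simpa using prodVec_smul_right 0 f 0
      simp [this]
    exact ofReal_inner_rhoSign_le hσ hη hη1 hκ hηκ s hf hg b

end

end DataHiding


/-! ### The two halves together, and the choice of constants. -/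

open DataHiding in
theorem proposition2 (σ : ℝ) (hσ : 0 < σ) :
    (∃ (T : ℝ → Op) (S : ℝ → Set (Fin 4 → ℝ)),
      (∀ s, ∃ V, IsCenteredGaussianState (T s) V) ∧ (∀ s, MeasurableSet (S s)) ∧
      Tendsto (fun s => gaussianSuccess σ s (T s) (S s)) atTop (𝓝 1)) ∧
    (∃ c : ℝ, c < 1 ∧ ∀ s : ℝ, 0 ≤ s → ∀ p, IsGLOCCMeasurement p →
      gloccSuccess σ s p ≤ ENNReal.ofReal c) := by
  refine ⟨⟨fun s => rankOne ℂ (squeezedVacuum s) (squeezedVacuum s), fun _ => {y | 0 < alpha y},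
    fun s => ⟨_, isCenteredGaussianState_squeezedVacuum s⟩,
    fun _ => measurableSet_lt measurable_const continuous_alpha.measurable,
    tendsto_gaussianSuccess hσ⟩, ?_⟩
  have hp := priorMin_pos hσ
  have hK : 1 ≤ Real.exp 8 := Real.one_le_exp (by norm_num)
  -- In units of `priorMin σ * η / (e⁸ κ)`, the gain on `box 1` is `8`; this `κ` makes the cost of
  -- `box 6` equal to `4`, and this `η` makes that of the small box equal to `2`, so a net gain of
  -- `2` remains.
  set κ := 72 * Real.exp 8 with hκ
  set η := 1 / (32 * Real.exp 8 * κ) with hη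
  have hη1 : η ≤ 1 := by
    rw [hη, div_le_one (by positivity)]
    nlinarith
  refine ⟨1 + priorMin σ * (64 * η ^ 2) + priorMin σ * η / (2 * κ ^ 2) * 576
    - priorMin σ * η / (2 * Real.exp 8 * κ) * 16, ?_, fun s _ p hs => ?_⟩
  · have h : priorMin σ * (64 * η ^ 2) + priorMin σ * η / (2 * κ ^ 2) * 576
        - priorMin σ * η / (2 * Real.exp 8 * κ) * 16 =
        -(priorMin σ * η * (2 / (Real.exp 8 * κ))) := by
      rw [hη, hκ]
      field_simp
      norm_num
    have h' : 0 < priorMin σ * η * (2 / (Real.exp 8 * κ)) := by positivity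
    linarith
  · rw [← lintegral_weight hσ (by positivity) (by positivity) (by nlinarith)]
    exact gloccSuccess_le hσ (by positivity) hη1 (by positivity) (by nlinarith) s hs
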